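/- Let $\Omega\subset\mathbb R^d$, $d\in\{2,3\}$, be a polygonal/polyhedral domain (open, connected, equal to the interior of its closure) with a conforming partition $\mathcal T_h$ into finitely many non-overlapping non-degenerate simplices. Let $\partial\Omega=\bar\Gamma_D\cup\bar\Gamma_N$ with $\Gamma_D\cap\Gamma_N=\emptyset$ and $\Gamma_D\neq\emptyset$, each boundary facet having its relative interior contained in $\Gamma_D$ (Dirichlet facet) or in $\Gamma_N$ (Neumann facet). Let $f\in L^2(\Omega)$, $g_D\in C(\Gamma_D)\cap L^2(\Gamma_D)$, $g_N\in L^2(\Gamma_N)$, let $\nu>0$ be constant in each element, and let $\tau$ be a measurable stabilization function on the element boundaries (possibly double-valued on interior facets) with $0<c\le\tau\le C$. Fix $p\ge 0$; $\mathbb P^p$ denotes polynomials of total degree at most $p$, $\Pi_K^p$ and $\Pi_e^p$ are the $L^2(K)$- and $L^2(e)$-orthogonal projections onto $\mathbb P^p(K)$ and $\mathbb P^p(e)$, and $n$ is the outward unit normal. Let $(u_h,q_h)$, with $u_h|_K\in\mathbb P^p(K)$ and $q_h|_K\in[\mathbb P^p(K)]^d$, be an HDG approximation: for every $K\in\mathcal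 T_h$, $$(\nu^{-1}q_h,v)_K-(u_h,\nabla\cdot v)_K+\langle\widehat u_h,v\cdot n\rangle_{\partial K}=0\quad\forall v\in[\mathbb P^p(K)]^d,$$ $$-(q_h,\nabla w)_K+\langle\widehat q_h\cdot n,w\rangle_{\partial K}=(f,w)_K\quad\forall w\in\mathbb P^p(K),$$ where on an interior facet shared by $K^+$ and $K^-$, with the superscripts $\pm$ denoting traces from $K^\pm$, $$\widehat u_h=\tfrac{\tau^+u_h^++\tau^-u_h^-+q_h^+\cdot n^++q_h^-\cdot n^-}{\tau^++\tau^-},\qquad \widehat q_h=\tfrac{\tau^-q_h^++\tau^+q_h^-+\tau^+\tau^-(u_h^+n^++u_h^-n^-)}{\tau^++\tau^-},$$ on Dirichlet facets $\widehat u_h=\Pi_e^pg_D$ and $\widehat q_h\cdot n=q_h\cdot n+\tau(u_h-\Pi_e^pg_D)$, and on Neumann facets $\widehat q_h\cdot n=\Pi_e^pg_N$ and $\widehat u_h=u_h+\tau^{-1}(q_h\cdot n-\Pi_e^pg_N)$. Let $\tilde q_h^\pi$ be the post-processed flux: for each $K\in\mathcal T_h$, $\tilde q_h^\pi|_K\in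 RT^p(K)=[\mathbb P^p(K)]^d+x\,\mathbb P^p(K)$ satisfies $$\langle(\tilde q_h^\pi-\widehat q_h)\cdot n,\mu\rangle_e=0\quad\forall\mu\in\mathbb P^p(e),\ \text{for every facet } e \text{ of } K,$$ $$(\tilde q_h^\pi-q_h,v)_K=0\quad\forall v\in[\mathbb P^{p-1}(K)]^d\quad(\text{if }p\ge1).$$ Then $\tilde q_h^\pi$ satisfies the projected equilibration conditions with both degrees equal to $p$: $\tilde q_h^\pi\in H(\mathrm{div};\Omega)$; $\nabla\cdot\tilde q_h^\pi|_K=\Pi_K^pf$ for every $K\in\mathcal T_h$; and $\tilde q_h^\pi\cdot n|_e=\Pi_e^pg_N$ for every Neumann facet $e$. -/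

import Mathlib

/-!
A Raviart–Thomas field of order `p` has a normal component in `ℙ^p` on each facet, so its moments of
degree at most `p` determine it there. Testing with the facet moments of `qhat`, which agree on the
two sides of an interior facet and equal those of `gN` on a Neumann facet, makes the normal
component of `σ` single-valued on interior facets and equal to the projection of `gN` on Neumann
facets. A single-valued normal component is what makes the elementwise divergences add up to a weak
divergence on `Ω`. In an element, integration by parts turns both families of moments of `σ` into
the balance equation for `q` and `qhat`, so `divergence σ - f` is orthogonal to `ℙ^p`.

The divergence theorem on a simplex is reduced to the fundamental theorem of calculus along an edge:
each line parallel to the edge joining the vertices `j` and `k` enters and leaves the simplex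
through the two facets opposite to these vertices, and the edge directions span the space.
-/

open MeasureTheory
open scoped RealInnerProductSpace ContDiff

namespace HDG

/-- The Euclidean space `ℝ^d`. -/
abbrev Pt (d : ℕ) : Type := EuclideanSpace ℝ (Fin d)

/-! ### Polynomials -/

/-- `f ∈ ℙ^p`: a real polynomial function of total degree at most `p` in `d` variables.
Elements of `ℙ^p(K)` and `ℙ^p(e)` are the restrictions of such functions. -/
def IsPoly {d : ℕ} (p : ℕ) (f : Pt d → ℝ) : Prop :=
  ∃ P : MvPolynomial (Fin d) ℝ, P.totalDegree ≤ p ∧ ∀ x : Pt d, f x = MvPolynomial.eval (fun k => x k) P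

/-- `v ∈ [ℙ^p]^d`. -/
def IsPolyVec {d : ℕ} (p : ℕ) (v : Pt d → Pt d) : Prop :=
  ∀ k : Fin d, IsPoly p (fun x => v x k)

/-- `v ∈ RT^p = [ℙ^p]^d + x ℙ^p`. -/
def IsRaviartThomas {d : ℕ} (p : ℕ) (v : Pt d → Pt d) : Prop :=
  ∃ (a : Pt d → Pt d) (s : Pt d → ℝ), IsPolyVec p a ∧ IsPoly p s ∧ ∀ x, v x = a x + s x • x

/-- The classical divergence `∑ₖ ∂ₖ vₖ`. -/
noncomputable def divergence {d : ℕ} (v : Pt d → Pt d) (x : Pt d) : ℝ :=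
  ∑ k : Fin d, fderiv ℝ v x (EuclideanSpace.single k 1) k

/-! ### `L²`-orthogonal projection onto polynomials -/

/-- `π` is the orthogonal projection in `L²(μ)` of `g` onto `ℙ^p`. -/
def IsL2Proj {d : ℕ} (μ : Measure (Pt d)) (p : ℕ) (g π : Pt d → ℝ) : Prop :=
  IsPoly p π ∧ ∀ w : Pt d → ℝ, IsPoly p w → ∫ x, (g x - π x) * w x ∂μ = 0

open Classical in
/-- The orthogonal projection in `L²(μ)` of `g` onto `ℙ^p`. It exists for `g ∈ L²(μ)` and is unique
`μ`-almost everywhere, see `l2Proj_spec` and `IsL2Proj.ae_eq`. -/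
noncomputable def l2Proj {d : ℕ} (μ : Measure (Pt d)) (p : ℕ) (g : Pt d → ℝ) : Pt d → ℝ :=
  if h : ∃ π, IsL2Proj μ p g π then h.choose else 0

theorem l2Proj_spec {d : ℕ} (μ : Measure (Pt d)) (p : ℕ) (g : Pt d → ℝ)
    (hμ : ∀ w : Pt d → ℝ, IsPoly p w → MemLp w 2 μ) (hg : MemLp g 2 μ) :
    IsL2Proj μ p g (l2Proj μ p g) := by
  have key : ∃ π, IsL2Proj μ p g π := by
    have hP : ∀ P : MvPolynomial.restrictTotalDegree (Fin d) ℝ p,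
        IsPoly p (fun x : Pt d => MvPolynomial.eval (fun k => x k) P.1) := fun P =>
      ⟨P.1, (MvPolynomial.mem_restrictTotalDegree _ _ _).1 P.2, fun _ => rfl⟩
    let T : MvPolynomial.restrictTotalDegree (Fin d) ℝ p →ₗ[ℝ] Lp ℝ 2 μ :=
      { toFun := fun P => (hμ _ (hP P)).toLp _
        map_add' := by
          intro P Q
          rw [← MemLp.toLp_add]
          congr 1
          ext x
          simp
        map_smul' := by
          intro c P
          rw [RingHom.id_apply, ← MemLp.toLp_const_smul]
          congr 1
          ext x
          simp }
    let S := LinearMap.range T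
    obtain ⟨P, hPy⟩ : S.starProjection (hg.toLp g) ∈ LinearMap.range T :=
      Submodule.starProjection_apply_mem S _
    refine ⟨fun x => MvPolynomial.eval (fun k => x k) P.1, hP P, fun w hw => ?_⟩
    obtain ⟨Q, hQ, hwQ⟩ := hw
    let Q' : MvPolynomial.restrictTotalDegree (Fin d) ℝ p :=
      ⟨Q, (MvPolynomial.mem_restrictTotalDegree _ _ _).2 hQ⟩
    have hw : w = fun x => MvPolynomial.eval (fun k => x k) Q'.1 := funext hwQ
    have h0 : inner ℝ (hg.toLp g - S.starProjection (hg.toLp g)) (T Q') = 0 :=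
      Submodule.starProjection_inner_eq_zero _ _ ⟨Q', rfl⟩
    rw [← hPy, L2.inner_def] at h0
    rw [← h0]
    apply integral_congr_ae
    filter_upwards [Lp.coeFn_sub (hg.toLp g) (T P), hg.coeFn_toLp,
      (hμ _ (hP P)).coeFn_toLp, (hμ _ (hP Q')).coeFn_toLp] with x h1 h2 h3 h4
    have h3' : (T P : Pt d → ℝ) x = MvPolynomial.eval (fun k => x k) P.1 := h3
    have h4' : (T Q' : Pt d → ℝ) x = MvPolynomial.eval (fun k => x k) Q'.1 := h4
    rw [h1, h4', Pi.sub_apply, h2, h3', hw]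
    simp [mul_comm]
  unfold l2Proj
  rw [dif_pos key]
  exact key.choose_spec

theorem IsL2Proj.ae_eq {d : ℕ} {μ : Measure (Pt d)} {p : ℕ} {g π₁ π₂ : Pt d → ℝ}
    (hμ : ∀ w : Pt d → ℝ, IsPoly p w → MemLp w 2 μ) (hg : MemLp g 2 μ)
    (h₁ : IsL2Proj μ p g π₁) (h₂ : IsL2Proj μ p g π₂) : π₁ =ᵐ[μ] π₂ := by
  have hd : IsPoly p (fun x => π₁ x - π₂ x) := by
    obtain ⟨P, hP, hP'⟩ := h₁.1
    obtain ⟨Q, hQ, hQ'⟩ := h₂.1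
    refine ⟨P - Q, (MvPolynomial.totalDegree_sub _ _).trans (max_le hP hQ), fun x => ?_⟩
    simp [hP', hQ']
  have i₁ : Integrable (fun x => (g x - π₁ x) * (π₁ x - π₂ x)) μ :=
    (hg.sub (hμ _ h₁.1)).integrable_mul (hμ _ hd)
  have i₂ : Integrable (fun x => (g x - π₂ x) * (π₁ x - π₂ x)) μ :=
    (hg.sub (hμ _ h₂.1)).integrable_mul (hμ _ hd)
  have i₃ : Integrable (fun x => (π₁ x - π₂ x) * (π₁ x - π₂ x)) μ :=
    (hμ _ hd).integrable_mul (hμ _ hd)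
  have h0 : ∫ x, (π₁ x - π₂ x) * (π₁ x - π₂ x) ∂μ = 0 := by
    have := integral_sub i₂ i₁
    rw [h₁.2 _ hd, h₂.2 _ hd, sub_zero] at this
    rw [← this]
    congr 1
    ext x
    ring
  rw [integral_eq_zero_iff_of_nonneg (fun x => mul_self_nonneg _) i₃] at h0
  filter_upwards [h0] with x hx
  have : π₁ x - π₂ x = 0 := mul_self_eq_zero.1 hx
  linarith

/-! ### `H(div; Ω)` -/

/-- `g ∈ L²(Ω)` is the weak divergence of `v` in the open set `Ω`. -/
def HasWeakDiv {d : ℕ} (Ω : Set (Pt d)) (v : Pt d → Pt d) (g : Pt d → ℝ) : Prop :=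
  MemLp g 2 (volume.restrict Ω) ∧
    ∀ φ : Pt d → ℝ, ContDiff ℝ ∞ φ → HasCompactSupport φ → tsupport φ ⊆ Ω →
      ∫ x in Ω, ⟪v x, gradient φ x⟫ = -∫ x in Ω, g x * φ x

/-- `v ∈ H(div; Ω)`. -/
def MemHDiv {d : ℕ} (Ω : Set (Pt d)) (v : Pt d → Pt d) : Prop :=
  MemLp v 2 (volume.restrict Ω) ∧ ∃ g, HasWeakDiv Ω v g

/-! ### Simplicial meshes -/

section Mesh

variable {d : ℕ} [NeZero d] {ι : Type*}

/-- The (closed) facet of a simplex opposite to its `j`-th vertex. -/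
def facet (s : Affine.Simplex ℝ (Pt d) d) (j : Fin (d + 1)) : Set (Pt d) :=
  (s.faceOpposite j).closedInterior

/-- The facet without its relative boundary. -/
def openFacet (s : Affine.Simplex ℝ (Pt d) d) (j : Fin (d + 1)) : Set (Pt d) :=
  (s.faceOpposite j).interior

/-- The `(d-1)`-dimensional surface measure in `ℝ^d`, normalised to agree with Lebesgue measure on
hyperplanes. -/
noncomputable def surf (d : ℕ) : Measure (Pt d) := Measure.euclideanHausdorffMeasure (d - 1)

/-- The unit normal on the facet opposite to the vertex `j`, pointing out of the simplex: the
direction from the vertex `j` to the foot of its altitude. -/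
noncomputable def normal (s : Affine.Simplex ℝ (Pt d) d) (j : Fin (d + 1)) : Pt d :=
  ‖s.altitudeFoot j - s.points j‖⁻¹ • (s.altitudeFoot j - s.points j)

theorem norm_normal (s : Affine.Simplex ℝ (Pt d) d) (j : Fin (d + 1)) : ‖normal s j‖ = 1 := by
  have h : s.altitudeFoot j - s.points j ≠ 0 := sub_ne_zero.2 (s.ne_altitudeFoot j).symm
  rw [normal, norm_smul, norm_inv, norm_norm, inv_mul_cancel₀ (norm_ne_zero_iff.2 h)]

/-- `K` is a conforming mesh of `Ω` by non-overlapping non-degenerate simplices: two distinct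
elements meet in the convex hull of their common vertices (the empty set or a common face). -/
structure IsMesh (Ω : Set (Pt d)) (K : ι → Affine.Simplex ℝ (Pt d) d) : Prop where
  cover : ⋃ i, (K i).closedInterior = closure Ω
  nonoverlapping : ∀ i i', i ≠ i' → Disjoint (K i).interior (K i').interior
  conforming : ∀ i i', i ≠ i' → (K i).closedInterior ∩ (K i').closedInterior =
    convexHull ℝ (Set.range (K i).points ∩ Set.range (K i').points)

/-- The facet `j` of `K i` and the facet `j'` of `K i'` are the two sides of one interior facet. -/
def IsInteriorFacet (K : ι → Affine.Simplex ℝ (Pt d) d) (i : ι) (j : Fin (d + 1)) (i' : ι)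
    (j' : Fin (d + 1)) : Prop :=
  i ≠ i' ∧ facet (K i) j = facet (K i') j'

/-- The facet lies on `∂Ω` and belongs to the part `Γ` of `∂Ω`. -/
def IsBoundaryFacet (Ω Γ : Set (Pt d)) (s : Affine.Simplex ℝ (Pt d) d) (j : Fin (d + 1)) : Prop :=
  facet s j ⊆ frontier Ω ∧ openFacet s j ⊆ Γ

/-- `∂Ω` is divided into the disjoint parts `Γ_D` (non-empty) and `Γ_N`, and each boundary facet of
the mesh belongs to one of them. -/
structure IsBoundarySplit (Ω ΓD ΓN : Set (Pt d)) (K : ι → Affine.Simplex ℝ (Pt d) d) : Prop where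
  closure_union : closure ΓD ∪ closure ΓN = frontier Ω
  disjoint : Disjoint ΓD ΓN
  nonempty : ΓD.Nonempty
  resolved : ∀ i j, facet (K i) j ⊆ frontier Ω →
    IsBoundaryFacet Ω ΓD (K i) j ∨ IsBoundaryFacet Ω ΓN (K i) j

/-- The field on `Ω` whose restriction to the interior of each element `K i` is `σ i`
(extended by zero to the null set of the remaining points). -/
noncomputable def glue [Fintype ι] (K : ι → Affine.Simplex ℝ (Pt d) d) (σ : ι → Pt d → Pt d) :
    Pt d → Pt d :=
  fun x => ∑ i, (K i).interior.indicator (σ i) x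

/-- The projection `Π_K^p g`. -/
noncomputable def projElt (s : Affine.Simplex ℝ (Pt d) d) (p : ℕ) (g : Pt d → ℝ) : Pt d → ℝ :=
  l2Proj (volume.restrict s.closedInterior) p g

/-- The projection `Π_e^p g`, `e` being the facet of `s` opposite to the vertex `j`. -/
noncomputable def projFacet (s : Affine.Simplex ℝ (Pt d) d) (j : Fin (d + 1)) (p : ℕ)
    (g : Pt d → ℝ) : Pt d → ℝ :=
  l2Proj ((surf d).restrict (facet s j)) p g

/-! ### The HDG method -/

/-- The HDG equations of order `p`. The broken polynomial functions `u_h` and `q_h` are given by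
their polynomial restrictions `u i`, `q i` to the elements `K i`, which also give the traces from
inside `K i`. The stabilization function on facet `j` of `K i` is `τ i j`, and `uhat i j`, `qhat i j`
are the numerical traces there (on boundary facets only the normal component of `qhat` matters). -/
structure IsHDGSolution (Ω ΓD ΓN : Set (Pt d)) (K : ι → Affine.Simplex ℝ (Pt d) d) (p : ℕ)
    (ν f gD gN : Pt d → ℝ) (τ : ι → Fin (d + 1) → Pt d → ℝ)
    (u : ι → Pt d → ℝ) (q : ι → Pt d → Pt d)
    (uhat : ι → Fin (d + 1) → Pt d → ℝ) (qhat : ι → Fin (d + 1) → Pt d → Pt d) : Prop where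
  u_poly : ∀ i, IsPoly p (u i)
  q_poly : ∀ i, IsPolyVec p (q i)
  uhat_interior : ∀ i j i' j', IsInteriorFacet K i j i' j' → ∀ x ∈ facet (K i) j,
    uhat i j x = τ i j x / (τ i j x + τ i' j' x) * u i x
      + τ i' j' x / (τ i j x + τ i' j' x) * u i' x
      + 1 / (τ i j x + τ i' j' x) * (⟪q i x, normal (K i) j⟫ + ⟪q i' x, normal (K i') j'⟫)
  qhat_interior : ∀ i j i' j', IsInteriorFacet K i j i' j' → ∀ x ∈ facet (K i) j,
    qhat i j x = (τ i' j' x / (τ i j x + τ i' j' x)) • q i x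
      + (τ i j x / (τ i j x + τ i' j' x)) • q i' x
      + (τ i j x * τ i' j' x / (τ i j x + τ i' j' x)) •
        (u i x • normal (K i) j + u i' x • normal (K i') j')
  uhat_dirichlet : ∀ i j, IsBoundaryFacet Ω ΓD (K i) j → ∀ x ∈ facet (K i) j,
    uhat i j x = projFacet (K i) j p gD x
  qhat_dirichlet : ∀ i j, IsBoundaryFacet Ω ΓD (K i) j → ∀ x ∈ facet (K i) j,
    ⟪qhat i j x, normal (K i) j⟫ =
      ⟪q i x, normal (K i) j⟫ + τ i j x * (u i x - projFacet (K i) j p gD x)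
  qhat_neumann : ∀ i j, IsBoundaryFacet Ω ΓN (K i) j → ∀ x ∈ facet (K i) j,
    ⟪qhat i j x, normal (K i) j⟫ = projFacet (K i) j p gN x
  uhat_neumann : ∀ i j, IsBoundaryFacet Ω ΓN (K i) j → ∀ x ∈ facet (K i) j,
    uhat i j x = u i x + 1 / τ i j x * (⟪q i x, normal (K i) j⟫ - projFacet (K i) j p gN x)
  eq_flux : ∀ i, ∀ v : Pt d → Pt d, IsPolyVec p v →
    (∫ x in (K i).closedInterior, (ν x)⁻¹ * ⟪q i x, v x⟫)
      - (∫ x in (K i).closedInterior, u i x * divergence v x)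
      + ∑ j, ∫ x in facet (K i) j, uhat i j x * ⟪v x, normal (K i) j⟫ ∂(surf d) = 0
  eq_balance : ∀ i, ∀ w : Pt d → ℝ, IsPoly p w →
    -(∫ x in (K i).closedInterior, ⟪q i x, gradient w x⟫)
      + ∑ j, ∫ x in facet (K i) j, ⟪qhat i j x, normal (K i) j⟫ * w x ∂(surf d)
      = ∫ x in (K i).closedInterior, f x * w x

/-- The elementwise Raviart–Thomas post-processing `σ` of the HDG flux `q_h` and of its numerical
trace `qhat`. -/
structure IsPostprocessedFlux (K : ι → Affine.Simplex ℝ (Pt d) d) (p : ℕ) (q : ι → Pt d → Pt d)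
    (qhat : ι → Fin (d + 1) → Pt d → Pt d) (σ : ι → Pt d → Pt d) : Prop where
  raviartThomas : ∀ i, IsRaviartThomas p (σ i)
  facet_moments : ∀ i j, ∀ μ : Pt d → ℝ, IsPoly p μ →
    ∫ x in facet (K i) j, ⟪σ i x - qhat i j x, normal (K i) j⟫ * μ x ∂(surf d) = 0
  element_moments : 1 ≤ p → ∀ i, ∀ v : Pt d → Pt d, IsPolyVec (p - 1) v →
    ∫ x in (K i).closedInterior, ⟪σ i x - q i x, v x⟫ = 0

/-- The field with restrictions `σ i` to the elements is a projected equilibrated flux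
reconstruction associated with the pair of degrees `(a, b)`. -/
structure IsProjectedEquilibratedFlux [Fintype ι] (Ω ΓN : Set (Pt d))
    (K : ι → Affine.Simplex ℝ (Pt d) d) (f gN : Pt d → ℝ) (a b : ℕ) (σ : ι → Pt d → Pt d) :
    Prop where
  mem_hdiv : MemHDiv Ω (glue K σ)
  div_eq : ∀ g, HasWeakDiv Ω (glue K σ) g → ∀ i,
    g =ᵐ[volume.restrict (K i).closedInterior] projElt (K i) a f
  normal_eq : ∀ i j, IsBoundaryFacet Ω ΓN (K i) j → ∀ x ∈ facet (K i) j,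
    ⟪σ i x, normal (K i) j⟫ = projFacet (K i) j b gN x

end Mesh

end HDG

open HDG

namespace HDG

section BarycentricCoordinates

variable {d : ℕ} (s : Affine.Simplex ℝ (Pt d) d)

/-- The vertices of a `d`-simplex in `ℝ^d` as an affine basis. -/
noncomputable def vertexBasis : AffineBasis (Fin (d + 1)) ℝ (Pt d) :=
  ⟨s.points, s.independent,
    s.independent.affineSpan_eq_top_iff_card_eq_finrank_add_one.2 (by simp)⟩

/-- The barycentric coordinate belonging to the vertex `j` of a simplex. -/
noncomputable def bary (j : Fin (d + 1)) : Pt d →ᵃ[ℝ] ℝ :=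
  (vertexBasis s).coord j

theorem bary_point (j k : Fin (d + 1)) : bary s j (s.points k) = if j = k then 1 else 0 :=
  (vertexBasis s).coord_apply j k

theorem sum_bary (x : Pt d) : ∑ j, bary s j x = 1 :=
  (vertexBasis s).sum_coord_apply_eq_one x

theorem affineCombination_bary (x : Pt d) :
    Finset.univ.affineCombination ℝ s.points (fun j => bary s j x) = x :=
  (vertexBasis s).affineCombination_coord_eq_self x

theorem continuous_bary (j : Fin (d + 1)) : Continuous (bary s j) :=
  continuous_barycentric_coord (vertexBasis s) j

theorem bary_add_smul (j : Fin (d + 1)) (x v : Pt d) (t : ℝ) :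
    bary s j (x + t • v) = bary s j x + t * (bary s j).linear v := by
  rw [add_comm x, ← vadd_eq_add, (bary s j).map_vadd, map_smul, vadd_eq_add, smul_eq_mul,
    add_comm]

theorem mem_closedInterior_iff {x : Pt d} : x ∈ s.closedInterior ↔ ∀ j, 0 ≤ bary s j x := by
  rw [← s.convexHull_eq_closedInterior]
  exact Set.ext_iff.1 (vertexBasis s).convexHull_eq_nonneg_coord x

theorem convex_closedInterior : Convex ℝ s.closedInterior :=
  s.convexHull_eq_closedInterior ▸ convex_convexHull ℝ _

end BarycentricCoordinates

section SimplexGeometry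

variable {d : ℕ} [NeZero d] (s : Affine.Simplex ℝ (Pt d) d)

theorem interior_closedInterior : interior s.closedInterior = s.interior := by
  rw [← s.convexHull_eq_closedInterior]
  refine (vertexBasis s).interior_convexHull.trans (Set.ext fun x => ?_)
  change (∀ j, 0 < bary s j x) ↔ x ∈ s.interior
  conv_rhs => rw [← affineCombination_bary s x]
  rw [Affine.Simplex.affineCombination_mem_interior_iff (sum_bary s x)]
  refine ⟨fun hpos j => ⟨hpos j, ?_⟩, fun h j => (h j).1⟩
  obtain ⟨k, hkj⟩ : ∃ k, k ≠ j := exists_ne j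
  rw [← sum_bary s x]
  exact Finset.single_lt_sum hkj (Finset.mem_univ j) (Finset.mem_univ k) (hpos k)
    fun i _ _ => (hpos i).le

theorem mem_interior_iff {x : Pt d} : x ∈ s.interior ↔ ∀ j, 0 < bary s j x := by
  rw [← interior_closedInterior, ← s.convexHull_eq_closedInterior]
  exact Set.ext_iff.1 (vertexBasis s).interior_convexHull x

theorem isOpen_simplexInterior : IsOpen s.interior :=
  interior_closedInterior s ▸ isOpen_interior

theorem interior_ae_eq_closedInterior : s.interior =ᵐ[volume] s.closedInterior :=
  interior_closedInterior s ▸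
    interior_ae_eq_of_null_frontier ((convex_closedInterior s).addHaar_frontier volume)

theorem mem_facet_iff {j : Fin (d + 1)} {x : Pt d} :
    x ∈ facet s j ↔ bary s j x = 0 ∧ ∀ k, 0 ≤ bary s k x := by
  conv_lhs => rw [← affineCombination_bary s x]
  rw [facet, Affine.Simplex.faceOpposite,
    Affine.Simplex.affineCombination_mem_closedInterior_face_iff_nonneg _ _ (sum_bary s x)]
  simp only [Finset.mem_compl, Finset.mem_singleton, not_not, forall_eq]
  grind

theorem facet_subset_closedInterior (j : Fin (d + 1)) : facet s j ⊆ s.closedInterior :=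
  s.closedInterior_faceOpposite_subset_closedInterior j

theorem isCompact_facet (j : Fin (d + 1)) : IsCompact (facet s j) :=
  (s.faceOpposite j).isCompact_closedInterior

theorem facet_eq_convexHull (j : Fin (d + 1)) :
    facet s j = convexHull ℝ (s.points '' {j}ᶜ) := by
  rw [facet, ← Affine.Simplex.convexHull_eq_closedInterior,
    Affine.Simplex.range_faceOpposite_points]

theorem facet_injective : Function.Injective (facet s) := by
  intro j k hjk
  by_contra hne
  have hk : s.points k ∈ facet s j :=
    s.point_mem_closedInterior_faceOpposite_iff.2 (Ne.symm hne)
  rw [hjk] at hk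
  exact s.point_mem_closedInterior_faceOpposite_iff.1 hk rfl

theorem inner_normal_point (j k : Fin (d + 1)) :
    ⟪normal s j, s.points k - s.altitudeFoot j⟫ = if j = k then -s.height j else 0 := by
  rw [normal, inner_smul_left, ← neg_sub (s.points j), inner_neg_left, norm_neg, conj_trivial]
  split_ifs with hjk
  · subst hjk
    have hheight := (s.height_pos j).ne'
    rw [Affine.Simplex.height, dist_eq_norm] at *
    rw [real_inner_self_eq_norm_sq]
    field_simp
  · have horth : ⟪s.points k - s.altitudeFoot j, s.points j - s.altitudeFoot j⟫ = 0 :=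
      s.inner_vsub_altitudeFoot_vsub_altitudeFoot_eq_zero hjk
    rw [real_inner_comm, horth, neg_zero, mul_zero]

theorem inner_normal_sub_altitudeFoot (j : Fin (d + 1)) (x : Pt d) :
    ⟪normal s j, x - s.altitudeFoot j⟫ = -s.height j * bary s j x := by
  conv_lhs => rw [← affineCombination_bary s x, ← vsub_eq_sub,
    ← Finset.univ.sum_smul_vsub_const_eq_affineCombination_vsub _ _ _ (sum_bary s x)]
  simp_rw [inner_sum, inner_smul_right, vsub_eq_sub, inner_normal_point, mul_ite, mul_zero]
  rw [Finset.sum_ite_eq, if_pos (Finset.mem_univ j), mul_comm]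

theorem inner_normal_eq (j : Fin (d + 1)) (v : Pt d) :
    ⟪normal s j, v⟫ = -s.height j * (bary s j).linear v := by
  have hvadd := inner_normal_sub_altitudeFoot s j (s.altitudeFoot j + (1 : ℝ) • v)
  have hfoot := inner_normal_sub_altitudeFoot s j (s.altitudeFoot j)
  rw [sub_self, inner_zero_right] at hfoot
  rwa [bary_add_smul, mul_add, ← hfoot, zero_add, one_mul, one_smul, add_sub_cancel_left] at hvadd

end SimplexGeometry

section FacetInterior

theorem nonempty_simplexInterior {V P : Type*} [AddCommGroup V] [Module ℝ V] [AddTorsor V P]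
    {n : ℕ} [NeZero n] (s : Affine.Simplex ℝ P n) : s.interior.Nonempty := by
  have hn : (0 : ℝ) < n := Nat.cast_pos.2 (NeZero.pos n)
  have hsum : ∑ _i : Fin (n + 1), ((n : ℝ) + 1)⁻¹ = 1 := by
    rw [Finset.sum_const, Finset.card_univ, Fintype.card_fin, nsmul_eq_mul, Nat.cast_succ,
      mul_inv_cancel₀ (by positivity)]
  exact ⟨_, (Affine.Simplex.affineCombination_mem_interior_iff hsum).2
    fun _ => ⟨by positivity, inv_lt_one_of_one_lt₀ (by linarith)⟩⟩

variable {d : ℕ} [d.AtLeastTwo] (s : Affine.Simplex ℝ (Pt d) d) {j : Fin (d + 1)}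

theorem mem_openFacet_iff {x : Pt d} :
    x ∈ openFacet s j ↔ bary s j x = 0 ∧ ∀ k, k ≠ j → 0 < bary s k x := by
  have := Nat.AtLeastTwo.neZero_sub_one d
  conv_lhs => rw [← affineCombination_bary s x]
  rw [openFacet, Affine.Simplex.faceOpposite,
    Affine.Simplex.affineCombination_mem_interior_face_iff_pos _ _ (sum_bary s x)]
  simp only [Finset.mem_compl, Finset.mem_singleton, not_not, forall_eq]
  exact and_comm

theorem openFacet_subset_facet : openFacet s j ⊆ facet s j :=
  (s.faceOpposite j).interior_subset_closedInterior

theorem eventually_mem_interior_of_mem_openFacet {x : Pt d} (hx : x ∈ openFacet s j) :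
    ∀ᶠ y in nhds x, 0 < bary s j y → y ∈ s.interior := by
  have hpos : ∀ k, k ≠ j → ∀ᶠ y in nhds x, 0 < bary s k y := fun k hk =>
    (continuous_bary s k).continuousAt.eventually_const_lt (((mem_openFacet_iff s).1 hx).2 k hk)
  have hall : ∀ᶠ y in nhds x, ∀ k, k ≠ j → 0 < bary s k y :=
    Filter.eventually_all.2 fun k => Filter.eventually_all.2 fun hk => hpos k hk
  filter_upwards [hall] with y hy hyj
  exact (mem_interior_iff s).2 fun k => (eq_or_ne k j).elim (fun h => h ▸ hyj) (hy k)

theorem nonempty_openFacet : (openFacet s j).Nonempty := by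
  have := Nat.AtLeastTwo.neZero_sub_one d
  exact nonempty_simplexInterior (s.faceOpposite j)

theorem facet_subset_closure_openFacet : facet s j ⊆ closure (openFacet s j) := by
  intro x hx
  obtain ⟨c, hc⟩ := nonempty_openFacet s (j := j)
  rw [mem_facet_iff] at hx
  rw [mem_openFacet_iff] at hc
  have hseg : ∀ t ∈ Set.Ioc (0 : ℝ) 1, AffineMap.lineMap x c t ∈ openFacet s j := by
    intro t ht
    simp only [mem_openFacet_iff, AffineMap.apply_lineMap, AffineMap.lineMap_apply_ring, hx.1,
      hc.1, mul_zero, add_zero, true_and]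
    intro k hk
    have hxk := mul_nonneg (sub_nonneg.2 ht.2) (hx.2 k)
    have hck := mul_pos ht.1 (hc.2 k hk)
    linarith
  have htendsto : Filter.Tendsto (fun t : ℝ => AffineMap.lineMap x c t)
      (nhdsWithin 0 (Set.Ioi 0)) (nhds x) := by
    have hcont : Continuous fun t : ℝ => AffineMap.lineMap x c t := AffineMap.lineMap_continuous
    simpa using (hcont.tendsto 0).mono_left nhdsWithin_le_nhds
  refine mem_closure_of_tendsto htendsto ?_
  filter_upwards [Ioc_mem_nhdsGT (zero_lt_one' ℝ)] with t ht using hseg t ht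

end FacetInterior

section Hyperplane

variable {E : Type*} [NormedAddCommGroup E] [InnerProductSpace ℝ E] {n : E}

/-- The hyperplane through `a` orthogonal to `n`. -/
def hyperplane (n a : E) : Set E := {x | ⟪n, x - a⟫ = 0}

/-- The isometric parametrization of `hyperplane n a` by its direction `nᗮ`. -/
def planeParam (n a : E) (w : (ℝ ∙ n)ᗮ) : E := a + w

theorem isClosed_hyperplane (n a : E) : IsClosed (hyperplane n a) :=
  isClosed_eq (by fun_prop) continuous_const

theorem isometry_planeParam (n a : E) : Isometry (planeParam n a) :=
  (isometry_add_left a).comp isometry_subtype_coe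

theorem range_planeParam (n a : E) : Set.range (planeParam n a) = hyperplane n a := by
  ext x
  constructor
  · rintro ⟨w, rfl⟩
    simpa [hyperplane, planeParam] using Submodule.mem_orthogonal_singleton_iff_inner_right.1 w.2
  · intro hx
    exact ⟨⟨x - a, Submodule.mem_orthogonal_singleton_iff_inner_right.2 hx⟩, by simp [planeParam]⟩

variable [FiniteDimensional ℝ E]

theorem isClosedEmbedding_planeParam (n a : E) : Topology.IsClosedEmbedding (planeParam n a) :=
  (isometry_planeParam n a).isClosedEmbedding

variable [MeasurableSpace E] [BorelSpace E]

theorem measurePreserving_planeParam_add_smul_normal (hn : ‖n‖ = 1) (a : E) :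
    MeasurePreserving (fun z : (ℝ ∙ n)ᗮ × ℝ => planeParam n a z.1 + z.2 • n)
      (volume.prod volume) volume := by
  have hprod : MeasurePreserving ((ℝ ∙ n).measurableEquivProd a).symm
      (volume.prod volume) (volume : Measure E) := by
    rw [← InnerProductSpace.euclideanHausdorffMeasure_eq_volume (V := E)]
    exact ((ℝ ∙ n).measurePreserving_measurableEquivProd a).symm
  have hspan : MeasurePreserving (LinearIsometryEquiv.toSpanUnitSingleton (𝕜 := ℝ) n hn)
      volume volume := LinearIsometryEquiv.measurePreserving _
  convert (hprod.comp (hspan.prod (MeasurePreserving.id volume))).comp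
    Measure.measurePreserving_swap using 2 with z
  obtain ⟨w, t⟩ := z
  simp only [Function.comp_apply, Prod.swap_prod_mk, Prod.map_apply, id,
    Submodule.measurableEquivProd_symm_apply, LinearIsometryEquiv.toSpanUnitSingleton_apply,
    planeParam, vadd_eq_add]
  abel

theorem measurePreserving_planeParam_add_smul (hn : ‖n‖ = 1) (a e : E) (he : ⟪n, e⟫ ≠ 0) :
    MeasurePreserving (fun z : (ℝ ∙ n)ᗮ × ℝ => planeParam n a z.1 + z.2 • e)
      (ENNReal.ofReal |⟪n, e⟫| • volume.prod volume) volume := by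
  have hperp : e - ⟪n, e⟫ • n ∈ (ℝ ∙ n)ᗮ := by
    rw [Submodule.mem_orthogonal_singleton_iff_inner_right, inner_sub_right, inner_smul_right,
      real_inner_self_eq_norm_sq, hn]
    ring
  let e' : (ℝ ∙ n)ᗮ := ⟨e - ⟪n, e⟫ • n, hperp⟩
  have hshear : MeasurePreserving (fun z : ℝ × (ℝ ∙ n)ᗮ => (⟪n, e⟫ * z.1, z.2 + z.1 • e'))
      ((ENNReal.ofReal |⟪n, e⟫| • volume).prod volume) (volume.prod volume) := by
    have hscale : MeasurePreserving (fun t : ℝ => ⟪n, e⟫ * t)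
        (ENNReal.ofReal |⟪n, e⟫| • volume) volume :=
      ⟨by fun_prop, by rw [Measure.map_smul, Real.smul_map_volume_mul_left he]⟩
    refine hscale.skew_product (g := fun t w => w + t • e') (by fun_prop) ?_
    exact Filter.Eventually.of_forall fun t => map_add_right_eq_self _ _
  rw [← Measure.prod_smul_right]
  convert (measurePreserving_planeParam_add_smul_normal hn a).comp
    ((Measure.measurePreserving_swap.comp hshear).comp Measure.measurePreserving_swap) using 2
    with z
  simp only [Function.comp_apply, Prod.swap_prod_mk, Prod.fst_swap, Prod.snd_swap, planeParam,
    Submodule.coe_add, Submodule.coe_smul, e', smul_sub, smul_smul, mul_comm ⟪n, e⟫]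
  abel

end Hyperplane

section SurfaceMeasure

variable {d : ℕ} {n : Pt d}

theorem surf_restrict_hyperplane (hn : ‖n‖ = 1) (a : Pt d) :
    (surf d).restrict (hyperplane n a) = (volume : Measure (ℝ ∙ n)ᗮ).map (planeParam n a) := by
  have hn0 : n ≠ 0 := by rintro rfl; simp at hn
  have hrank : Module.finrank ℝ (ℝ ∙ n)ᗮ = d - 1 := by
    have hadd := (ℝ ∙ n).finrank_add_finrank_orthogonal
    rw [finrank_span_singleton hn0, finrank_euclideanSpace_fin] at hadd
    omega
  rw [← range_planeParam, surf, ← (isometry_planeParam n a).map_euclideanHausdorffMeasure, ← hrank,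
    InnerProductSpace.euclideanHausdorffMeasure_eq_volume]

theorem surf_eq_volume_preimage (hn : ‖n‖ = 1) {a : Pt d} {S : Set (Pt d)}
    (hS : S ⊆ hyperplane n a) : surf d S = volume (planeParam n a ⁻¹' S) := by
  rw [← (isClosedEmbedding_planeParam n a).measurableEmbedding.map_apply,
    ← surf_restrict_hyperplane hn, Measure.restrict_apply' (isClosed_hyperplane n a).measurableSet,
    Set.inter_eq_left.2 hS]

theorem sFinite_surf_restrict_hyperplane (hn : ‖n‖ = 1) (a : Pt d) :
    SFinite ((surf d).restrict (hyperplane n a)) := by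
  rw [surf_restrict_hyperplane hn]
  infer_instance

theorem measurePreserving_hyperplane_add_smul (hn : ‖n‖ = 1) (a e : Pt d) (he : ⟪n, e⟫ ≠ 0) :
    MeasurePreserving (fun z : Pt d × ℝ => z.1 + z.2 • e)
      (ENNReal.ofReal |⟪n, e⟫| • ((surf d).restrict (hyperplane n a)).prod volume) volume := by
  refine ⟨by fun_prop, ?_⟩
  have hparam := (isClosedEmbedding_planeParam n a).continuous.measurable
  have hprod : ((volume : Measure (ℝ ∙ n)ᗮ).map (planeParam n a)).prod (volume : Measure ℝ) =
      (volume.prod volume).map (Prod.map (planeParam n a) id) := by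
    rw [← Measure.map_prod_map _ _ hparam measurable_id, Measure.map_id]
  rw [surf_restrict_hyperplane hn, hprod, Measure.map_smul,
    Measure.map_map (by fun_prop) (hparam.prodMap measurable_id), ← Measure.map_smul]
  exact (measurePreserving_planeParam_add_smul hn a e he).map_eq

theorem integral_eq_integral_hyperplane (hn : ‖n‖ = 1) (a e : Pt d) (he : ⟪n, e⟫ ≠ 0)
    {f : Pt d → ℝ} (hf : Integrable f) :
    ∫ x, f x = |⟪n, e⟫| * ∫ y in hyperplane n a, (∫ t : ℝ, f (y + t • e)) ∂(surf d) := by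
  have := sFinite_surf_restrict_hyperplane hn a
  have hsweep := measurePreserving_hyperplane_add_smul hn a e he
  have hfsweep := (hsweep.integrable_comp hf.1).2 hf
  simp only [Function.comp_def] at hfsweep
  rw [integrable_smul_measure (by simpa using he) ENNReal.ofReal_ne_top] at hfsweep
  rw [← hsweep.map_eq, integral_map hsweep.aemeasurable (by rw [hsweep.map_eq]; exact hf.1),
    integral_smul_measure, integral_prod _ hfsweep, ENNReal.toReal_ofReal (abs_nonneg _),
    smul_eq_mul]

theorem volume_slab_of_forall_add_smul_mem_iff (hn : ‖n‖ = 1) (a : Pt d) {e : Pt d}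
    (he : ⟪n, e⟫ ≠ 0) {B : Set (Pt d)} (hB : MeasurableSet B)
    (hBe : ∀ x (t : ℝ), x + t • e ∈ B ↔ x ∈ B) {ℓ : Pt d → ℝ} (hℓ : Measurable ℓ)
    (hℓe : ∀ x t, ℓ (x + t • e) = ℓ x + t) :
    volume (B ∩ ℓ ⁻¹' Set.Icc 0 1) = ENNReal.ofReal |⟪n, e⟫| * surf d (B ∩ hyperplane n a) := by
  have := sFinite_surf_restrict_hyperplane hn a
  have hsweep := measurePreserving_hyperplane_add_smul hn a e he
  have hslab : MeasurableSet (B ∩ ℓ ⁻¹' Set.Icc 0 1) := hB.inter (hℓ measurableSet_Icc)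
  have hslice (y : Pt d) :
      volume {t : ℝ | y + t • e ∈ B ∩ ℓ ⁻¹' Set.Icc 0 1} = B.indicator 1 y := by
    simp only [Set.mem_inter_iff, Set.mem_preimage, hBe, hℓe]
    by_cases hy : y ∈ B
    · simp only [hy, true_and, Set.indicator_of_mem, Pi.one_apply]
      change volume ((ℓ y + ·) ⁻¹' Set.Icc 0 1) = 1
      rw [measure_preimage_add, Real.volume_Icc, sub_zero, ENNReal.ofReal_one]
    · simp [hy]
  rw [← hsweep.measure_preimage hslab.nullMeasurableSet, Measure.smul_apply,
    Measure.prod_apply (hsweep.measurable hslab), smul_eq_mul]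
  change _ * ∫⁻ y, volume {t : ℝ | y + t • e ∈ B ∩ ℓ ⁻¹' Set.Icc 0 1} ∂_ = _
  rw [lintegral_congr hslice, lintegral_indicator_one hB, Measure.restrict_apply hB]

end SurfaceMeasure

section FacetMeasure

variable {d : ℕ} [NeZero d] (s : Affine.Simplex ℝ (Pt d) d) {j : Fin (d + 1)}

/-- The hyperplane containing the facet opposite to the vertex `j`. -/
abbrev facetPlane (j : Fin (d + 1)) : Set (Pt d) := hyperplane (normal s j) (s.altitudeFoot j)

theorem mem_facetPlane_iff {x : Pt d} : x ∈ facetPlane s j ↔ bary s j x = 0 := by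
  change ⟪normal s j, x - s.altitudeFoot j⟫ = 0 ↔ _
  rw [inner_normal_sub_altitudeFoot, neg_mul, neg_eq_zero, mul_eq_zero,
    or_iff_right (s.height_pos j).ne']

theorem facet_subset_facetPlane : facet s j ⊆ facetPlane s j :=
  fun _ hx => (mem_facetPlane_iff s).2 ((mem_facet_iff s).1 hx).1

instance isFiniteMeasure_surf_restrict_facet :
    IsFiniteMeasure ((surf d).restrict (facet s j)) := by
  have hcompact := (isClosedEmbedding_planeParam (normal s j) (s.altitudeFoot j)).isCompact_preimage
    (isCompact_facet s j)
  refine ⟨?_⟩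
  rw [Measure.restrict_apply_univ,
    surf_eq_volume_preimage (norm_normal s j) (facet_subset_facetPlane s)]
  exact hcompact.measure_lt_top

theorem integrableOn_facet {g : Pt d → ℝ} (hg : ContinuousOn g (facet s j)) :
    IntegrableOn g (facet s j) (surf d) := by
  have hmeas := (isCompact_facet s j).measurableSet
  obtain ⟨C, hC⟩ := (isCompact_facet s j).exists_bound_of_continuousOn hg
  exact Integrable.of_bound (hg.aestronglyMeasurable hmeas) C (ae_restrict_of_forall_mem hmeas hC)

end FacetMeasure

section FacetMeasureInterior

variable {d : ℕ} [d.AtLeastTwo] (s : Affine.Simplex ℝ (Pt d) d) {j : Fin (d + 1)}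

theorem isOpen_planeParam_preimage_openFacet :
    IsOpen (planeParam (normal s j) (s.altitudeFoot j) ⁻¹' openFacet s j) := by
  have hcont := (isClosedEmbedding_planeParam (normal s j) (s.altitudeFoot j)).continuous
  have hpos : planeParam (normal s j) (s.altitudeFoot j) ⁻¹' openFacet s j =
      ⋂ k ∈ ({j} : Set (Fin (d + 1)))ᶜ,
        {w | 0 < bary s k (planeParam (normal s j) (s.altitudeFoot j) w)} := by
    ext w
    have hplane : planeParam (normal s j) (s.altitudeFoot j) w ∈ facetPlane s j := by
      rw [facetPlane, ← range_planeParam]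
      exact Set.mem_range_self w
    simp [mem_openFacet_iff, (mem_facetPlane_iff s).1 hplane]
  rw [hpos]
  exact (Set.toFinite _).isOpen_biInter fun k _ =>
    isOpen_lt continuous_const ((continuous_bary s k).comp hcont)

theorem planeParam_preimage_facet_subset_closure :
    planeParam (normal s j) (s.altitudeFoot j) ⁻¹' facet s j ⊆
      closure (planeParam (normal s j) (s.altitudeFoot j) ⁻¹' openFacet s j) := by
  have hrange : openFacet s j ⊆ Set.range (planeParam (normal s j) (s.altitudeFoot j)) := by
    rw [range_planeParam]
    exact (openFacet_subset_facet s).trans (facet_subset_facetPlane s)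
  rw [(isClosedEmbedding_planeParam _ _).isInducing.closure_eq_preimage_closure_image,
    Set.image_preimage_eq_of_subset hrange]
  exact Set.preimage_mono (facet_subset_closure_openFacet s)

theorem convex_openFacet : Convex ℝ (openFacet s j) := by
  intro x hx y hy a b ha hb hab
  rw [mem_openFacet_iff] at hx hy ⊢
  simp only [Convex.combo_affine_apply hab, smul_eq_mul, hx.1, hy.1, mul_zero, add_zero, true_and]
  exact fun k hk => (convex_Ioi (0 : ℝ)) (hx.2 k hk) (hy.2 k hk) ha hb hab

theorem openFacet_ae_eq_facet : openFacet s j =ᵐ[surf d] facet s j := by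
  refine Filter.EventuallyLE.antisymm (openFacet_subset_facet s).eventuallyLE (ae_le_set.2 ?_)
  have hconvex : Convex ℝ (planeParam (normal s j) (s.altitudeFoot j) ⁻¹' openFacet s j) :=
    ((convex_openFacet s).translate_preimage_right _).linear_preimage
      (ℝ ∙ normal s j)ᗮ.subtype
  rw [surf_eq_volume_preimage (norm_normal s j)
    (Set.sdiff_subset.trans (facet_subset_facetPlane s)), Set.preimage_sdiff]
  refine measure_mono_null ?_ (hconvex.addHaar_frontier volume)
  rw [(isOpen_planeParam_preimage_openFacet s).frontier_eq]
  exact Set.sdiff_subset_sdiff_left (planeParam_preimage_facet_subset_closure s)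

theorem eqOn_facet_of_ae_eq {f g : Pt d → ℝ} (hf : Continuous f) (hg : Continuous g)
    (hfg : f =ᵐ[(surf d).restrict (facet s j)] g) : Set.EqOn f g (facet s j) := by
  have hemb := isClosedEmbedding_planeParam (normal s j) (s.altitudeFoot j)
  have hplane : f =ᵐ[((surf d).restrict (facetPlane s j)).restrict (facet s j)] g := by
    rwa [Measure.restrict_restrict_of_subset (facet_subset_facetPlane s)]
  rw [surf_restrict_hyperplane (norm_normal s j), hemb.measurableEmbedding.restrict_map] at hplane
  have hopen := Measure.eqOn_open_of_ae_eq (ae_restrict_of_ae_restrict_of_subset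
      (Set.preimage_mono (openFacet_subset_facet s))
      ((hemb.measurableEmbedding.ae_map_iff (p := fun x => f x = g x)).1 hplane))
    (isOpen_planeParam_preimage_openFacet s) (hf.comp hemb.continuous).continuousOn
    (hg.comp hemb.continuous).continuousOn
  have hclosure := hopen.closure (hf.comp hemb.continuous) (hg.comp hemb.continuous)
  intro x hx
  obtain ⟨w, rfl⟩ : x ∈ Set.range (planeParam (normal s j) (s.altitudeFoot j)) := by
    rw [range_planeParam]
    exact facet_subset_facetPlane s hx
  exact hclosure (planeParam_preimage_facet_subset_closure s hx)

end FacetMeasureInterior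

section Edge

variable {d : ℕ} (s : Affine.Simplex ℝ (Pt d) d) {k l : Fin (d + 1)}

/-- The edge vector pointing from the vertex `l` to the vertex `k`. -/
def edge (k l : Fin (d + 1)) : Pt d := s.points k - s.points l

/-- The projection along the edge from `l` to `k` onto the hyperplane of the facet opposite to `k`.
It maps the facet opposite to `l` onto the facet opposite to `k`. -/
noncomputable def edgeProj (k l : Fin (d + 1)) (x : Pt d) : Pt d := x - bary s k x • edge s k l

theorem bary_linear_edge (j k l : Fin (d + 1)) :
    (bary s j).linear (edge s k l) = (if j = k then 1 else 0) - if j = l then 1 else 0 := by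
  rw [edge, ← vsub_eq_sub, AffineMap.linearMap_vsub, bary_point, bary_point, vsub_eq_sub]

theorem bary_edgeProj (j : Fin (d + 1)) (x : Pt d) :
    bary s j (edgeProj s k l x) = bary s j x - bary s k x * (bary s j).linear (edge s k l) := by
  rw [edgeProj, sub_eq_add_neg, ← neg_smul, bary_add_smul, neg_mul, sub_eq_add_neg]

theorem continuous_edgeProj : Continuous (edgeProj s k l) :=
  continuous_id.sub ((continuous_bary s k).smul continuous_const)

theorem edgeProj_add_smul_edge (hkl : k ≠ l) (x : Pt d) (t : ℝ) :
    edgeProj s k l (x + t • edge s k l) = edgeProj s k l x := by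
  simp only [edgeProj, bary_add_smul, bary_linear_edge, if_true, if_neg hkl]
  module

variable [NeZero d]

theorem edgeProj_of_mem_facetPlane {x : Pt d} (hx : x ∈ facetPlane s k) :
    edgeProj s k l x = x := by
  rw [edgeProj, (mem_facetPlane_iff s).1 hx, zero_smul, sub_zero]

theorem inner_normal_edge (j : Fin (d + 1)) :
    ⟪normal s j, edge s k l⟫ =
      s.height j * ((if j = l then 1 else 0) - if j = k then 1 else 0) := by
  rw [inner_normal_eq, bary_linear_edge]
  ring

theorem edgeProj_mem_facet_iff (hkl : k ≠ l) {x : Pt d} (hx : x ∈ facetPlane s l) :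
    edgeProj s k l x ∈ facet s k ↔ x ∈ facet s l := by
  rw [mem_facetPlane_iff] at hx
  have hbary (j : Fin (d + 1)) : bary s j (edgeProj s k l x) =
      if j = k then 0 else if j = l then bary s k x else bary s j x := by
    rw [bary_edgeProj, bary_linear_edge]
    split_ifs with hjk hjl hjl
    · exact absurd (hjk.symm.trans hjl) hkl
    · simp [hjk]
    · simp [hjl, hx]
    · simp
  simp only [mem_facet_iff, hbary, hx, true_and, if_true]
  constructor
  · intro h j
    rcases eq_or_ne j k with rfl | hjk
    · simpa [hkl.symm] using h l
    rcases eq_or_ne j l with rfl | hjl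
    · exact hx.ge
    · simpa [hjk, hjl] using h j
  · intro h j
    split_ifs
    exacts [le_rfl, h k, h j]

theorem add_smul_edge_mem_closedInterior_iff (hkl : k ≠ l) {y : Pt d} (hy : y ∈ facetPlane s l)
    (t : ℝ) : y + t • edge s k l ∈ s.closedInterior ↔
      y ∈ facet s l ∧ t ∈ Set.Icc (-bary s k y) 0 := by
  rw [mem_facetPlane_iff] at hy
  have hbary (j : Fin (d + 1)) : bary s j (y + t • edge s k l) =
      if j = k then bary s k y + t else if j = l then -t else bary s j y := by
    rw [bary_add_smul, bary_linear_edge]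
    split_ifs with hjk hjl hjl
    · exact absurd (hjk.symm.trans hjl) hkl
    · simp [hjk]
    · simp [hjl, hy]
    · simp
  simp only [mem_closedInterior_iff, mem_facet_iff, hbary, hy, true_and, Set.mem_Icc,
    neg_le_iff_add_nonneg']
  constructor
  · intro h
    have hk : 0 ≤ bary s k y + t := by simpa using h k
    have hl : t ≤ 0 := by simpa [hkl.symm] using h l
    refine ⟨fun j => ?_, hk, hl⟩
    rcases eq_or_ne j k with rfl | hjk
    · linarith
    rcases eq_or_ne j l with rfl | hjl
    · exact hy.ge
    · simpa [hjk, hjl] using h j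
  · rintro ⟨h, hk, hl⟩ j
    split_ifs
    exacts [hk, neg_nonneg.2 hl, h j]

theorem volume_preimage_edgeProj_inter_slab (hkl : k ≠ l) {m : Fin (d + 1)} (hm : m = k ∨ m = l)
    {B : Set (Pt d)} (hB : MeasurableSet B) :
    volume (edgeProj s k l ⁻¹' B ∩ bary s k ⁻¹' Set.Icc 0 1) =
      ENNReal.ofReal (s.height m) * surf d (edgeProj s k l ⁻¹' B ∩ facetPlane s m) := by
  have hinner : |⟪normal s m, edge s k l⟫| = s.height m := by
    rw [inner_normal_edge]
    rcases hm with rfl | rfl <;> simp [hkl, hkl.symm, abs_of_pos (s.height_pos _)]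
  rw [volume_slab_of_forall_add_smul_mem_iff (norm_normal s m) (s.altitudeFoot m)
    (abs_pos.1 (hinner ▸ s.height_pos m)) ((continuous_edgeProj s).measurable hB) _
    (continuous_bary s k).measurable _, hinner]
  · intro x t
    rw [Set.mem_preimage, edgeProj_add_smul_edge s hkl, Set.mem_preimage]
  · intro x t
    rw [bary_add_smul, bary_linear_edge, if_pos rfl, if_neg hkl, sub_zero, mul_one]

theorem measurePreserving_edgeProj (hkl : k ≠ l) :
    MeasurePreserving (edgeProj s k l)
      (ENNReal.ofReal (s.height l) • (surf d).restrict (facet s l))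
      (ENNReal.ofReal (s.height k) • (surf d).restrict (facet s k)) := by
  have hmeas := (continuous_edgeProj s (k := k) (l := l)).measurable
  refine ⟨hmeas, Measure.ext fun B hB => ?_⟩
  have hl : edgeProj s k l ⁻¹' B ∩ facet s l =
      edgeProj s k l ⁻¹' (B ∩ facet s k) ∩ facetPlane s l := by
    ext x
    have := @facet_subset_facetPlane _ _ s l x
    have := edgeProj_mem_facet_iff s hkl (x := x)
    simp only [Set.mem_inter_iff, Set.mem_preimage]
    tauto
  have hk : B ∩ facet s k = edgeProj s k l ⁻¹' (B ∩ facet s k) ∩ facetPlane s k := by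
    ext x
    have hfacet := @facet_subset_facetPlane _ _ s k x
    rw [Set.mem_inter_iff _ _ (facetPlane s k), Set.mem_preimage]
    constructor
    · intro hx
      rw [edgeProj_of_mem_facetPlane s (hfacet hx.2)]
      exact ⟨hx, hfacet hx.2⟩
    · rintro ⟨hx, hplane⟩
      rwa [edgeProj_of_mem_facetPlane s hplane] at hx
  have hBk := hB.inter (isCompact_facet s k).measurableSet
  rw [Measure.map_apply hmeas hB, Measure.smul_apply, Measure.smul_apply,
    Measure.restrict_apply (hmeas hB), Measure.restrict_apply hB, smul_eq_mul, smul_eq_mul]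
  calc ENNReal.ofReal (s.height l) * surf d (edgeProj s k l ⁻¹' B ∩ facet s l)
      = volume (edgeProj s k l ⁻¹' (B ∩ facet s k) ∩ bary s k ⁻¹' Set.Icc 0 1) := by
        rw [hl, volume_preimage_edgeProj_inter_slab s hkl (Or.inr rfl) hBk]
    _ = ENNReal.ofReal (s.height k) * surf d (B ∩ facet s k) := by
        rw [volume_preimage_edgeProj_inter_slab s hkl (Or.inl rfl) hBk, ← hk]

theorem integral_facet_edgeProj (hkl : k ≠ l) {g : Pt d → ℝ} (hg : Continuous g) :
    s.height l * ∫ y in facet s l, g (edgeProj s k l y) ∂(surf d) =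
      s.height k * ∫ y in facet s k, g y ∂(surf d) := by
  have hmp := measurePreserving_edgeProj s hkl
  have hint := integral_map hmp.aemeasurable (f := g) hg.aestronglyMeasurable
  rwa [hmp.map_eq, integral_smul_measure, integral_smul_measure,
    ENNReal.toReal_ofReal (s.height_pos _).le, ENNReal.toReal_ofReal (s.height_pos _).le,
    smul_eq_mul, smul_eq_mul, eq_comm] at hint

end Edge

section Calculus

theorem integral_fderiv_add_smul {E : Type*} [NormedAddCommGroup E] [NormedSpace ℝ E] {g : E → ℝ}
    (hg : ContDiff ℝ 1 g) (y e : E) (a b : ℝ) :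
    ∫ t in a..b, fderiv ℝ g (y + t • e) e = g (y + b • e) - g (y + a • e) := by
  have hline (t : ℝ) : HasDerivAt (fun t : ℝ => y + t • e) e t := by
    simpa using ((hasDerivAt_id t).smul_const e).const_add y
  have hcont : Continuous fun t : ℝ => fderiv ℝ g (y + t • e) e :=
    ((hg.continuous_fderiv one_ne_zero).comp (by fun_prop)).clm_apply continuous_const
  exact intervalIntegral.integral_eq_sub_of_hasDerivAt
    (fun t _ => (hg.differentiable one_ne_zero _).hasFDerivAt.comp_hasDerivAt t (hline t))
    (hcont.intervalIntegrable _ _)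

variable {d : ℕ} {v : Pt d → Pt d} {φ : Pt d → ℝ}

theorem fderiv_coord {x : Pt d} (hv : DifferentiableAt ℝ v x) (k : Fin d) (w : Pt d) :
    fderiv ℝ (fun y => v y k) x w = fderiv ℝ v x w k :=
  DFunLike.congr_fun
    ((EuclideanSpace.proj (𝕜 := ℝ) k).hasFDerivAt.comp x hv.hasFDerivAt).fderiv w

theorem continuous_divergence (hv : ContDiff ℝ 1 v) : Continuous (divergence v) := by
  have := hv.continuous_fderiv one_ne_zero
  unfold divergence
  fun_prop

theorem continuous_gradient (hφ : ContDiff ℝ 1 φ) : Continuous (gradient φ) :=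
  (InnerProductSpace.toDual ℝ (Pt d)).symm.continuous.comp (hφ.continuous_fderiv one_ne_zero)

theorem inner_gradient_eq_sum (φ : Pt d → ℝ) (x v : Pt d) :
    ⟪v, gradient φ x⟫ = ∑ k, v k * fderiv ℝ φ x (EuclideanSpace.single k 1) := by
  rw [real_inner_comm, gradient, InnerProductSpace.toDual_symm_apply]
  conv_lhs => rw [← (EuclideanSpace.basisFun (Fin d) ℝ).sum_repr v]
  simp

theorem divergence_smul {x : Pt d} (hφ : DifferentiableAt ℝ φ x) (hv : DifferentiableAt ℝ v x) :
    divergence (fun y => φ y • v y) x = ⟪v x, gradient φ x⟫ + divergence v x * φ x := by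
  rw [inner_gradient_eq_sum]
  simp only [divergence, fderiv_fun_smul hφ hv, Finset.sum_mul, ← Finset.sum_add_distrib]
  refine Finset.sum_congr rfl fun k _ => ?_
  simp only [add_apply, smul_apply, ContinuousLinearMap.smulRight_apply, PiLp.add_apply,
    PiLp.smul_apply, smul_eq_mul]
  ring

end Calculus

section DivergenceTheorem

variable {d : ℕ} [NeZero d] (s : Affine.Simplex ℝ (Pt d) d) {k l : Fin (d + 1)} {g : Pt d → ℝ}

theorem integral_indicator_fderiv_add_smul_edge (hkl : k ≠ l) (hg : ContDiff ℝ 1 g) {y : Pt d}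
    (hy : y ∈ facetPlane s l) :
    ∫ t : ℝ, s.closedInterior.indicator (fun x => fderiv ℝ g x (edge s k l)) (y + t • edge s k l) =
      (facet s l).indicator (fun y => g y - g (edgeProj s k l y)) y := by
  classical
  simp only [Set.indicator_apply, add_smul_edge_mem_closedInterior_iff s hkl hy]
  by_cases hyF : y ∈ facet s l
  · have hle : -bary s k y ≤ 0 := neg_nonpos.2 (((mem_facet_iff s).1 hyF).2 k)
    have hrestrict := integral_indicator (μ := volume)
      (f := fun t : ℝ => fderiv ℝ g (y + t • edge s k l) (edge s k l))
      (measurableSet_Icc (a := -bary s k y) (b := 0))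
    simp only [Set.indicator_apply] at hrestrict
    simp only [hyF, true_and, if_true]
    rw [hrestrict, integral_Icc_eq_integral_Ioc, ← intervalIntegral.integral_of_le hle,
      integral_fderiv_add_smul hg, zero_smul, add_zero, neg_smul, ← sub_eq_add_neg, edgeProj]
  · simp [hyF]

theorem integral_fderiv_edge (hkl : k ≠ l) (hg : ContDiff ℝ 1 g) :
    ∫ x in s.closedInterior, fderiv ℝ g x (edge s k l) =
      s.height l * ∫ y in facet s l, g y ∂(surf d) -
        s.height k * ∫ y in facet s k, g y ∂(surf d) := by
  have hK := s.isCompact_closedInterior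
  have hF := (isCompact_facet s l).measurableSet
  have hcont := (hg.continuous_fderiv one_ne_zero).clm_apply (continuous_const (y := edge s k l))
  have hinner : ⟪normal s l, edge s k l⟫ = s.height l := by
    rw [inner_normal_edge, if_pos rfl, if_neg hkl.symm, sub_zero, mul_one]
  have hsub := integral_sub (integrableOn_facet s (j := l) hg.continuous.continuousOn)
    (integrableOn_facet s
      (hg.continuous.comp (continuous_edgeProj s (k := k) (l := l))).continuousOn)
  simp only [Function.comp_apply] at hsub
  rw [← integral_facet_edgeProj s hkl hg.continuous, ← mul_sub, ← hsub,
    ← integral_indicator hK.measurableSet,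
    integral_eq_integral_hyperplane (norm_normal s l) (s.altitudeFoot l) (edge s k l)
      (hinner ▸ (s.height_pos l).ne')
      ((hcont.continuousOn.integrableOn_compact hK).integrable_indicator hK.measurableSet),
    hinner, abs_of_pos (s.height_pos l),
    setIntegral_congr_fun (isClosed_hyperplane _ _).measurableSet
      fun y hy => integral_indicator_fderiv_add_smul_edge s hkl hg hy,
    setIntegral_indicator hF, Set.inter_eq_right.2 (facet_subset_facetPlane s)]

theorem integral_fderiv_simplex (hg : ContDiff ℝ 1 g) (w : Pt d) :
    ∫ x in s.closedInterior, fderiv ℝ g x w =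
      ∑ j, ⟪normal s j, w⟫ * ∫ y in facet s j, g y ∂(surf d) := by
  have hint : IntegrableOn (fderiv ℝ g) s.closedInterior :=
    (hg.continuous_fderiv one_ne_zero).continuousOn.integrableOn_compact
      s.isCompact_closedInterior
  let volumeSide : Pt d →ₗ[ℝ] ℝ :=
    (∫ x in s.closedInterior, fderiv ℝ g x : Pt d →L[ℝ] ℝ).toLinearMap
  let facetSide : Pt d →ₗ[ℝ] ℝ :=
    ∑ j, (∫ y in facet s j, g y ∂(surf d)) • (innerSL ℝ (normal s j)).toLinearMap
  have hvolume (v : Pt d) : volumeSide v = ∫ x in s.closedInterior, fderiv ℝ g x v :=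
    ContinuousLinearMap.integral_apply hint v
  have hfacet (v : Pt d) :
      facetSide v = ∑ j, ⟪normal s j, v⟫ * ∫ y in facet s j, g y ∂(surf d) := by
    simp [facetSide, mul_comm]
  -- The edges emanating from one vertex span the space.
  suffices volumeSide = facetSide by rw [← hvolume, ← hfacet, this]
  refine ((vertexBasis s).basisOf 0).ext fun ⟨k, hk⟩ => ?_
  rw [AffineBasis.basisOf_apply]
  change volumeSide (edge s k 0) = facetSide (edge s k 0)
  rw [hvolume, hfacet, integral_fderiv_edge s hk hg]
  simp [inner_normal_edge, mul_sub, sub_mul]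

theorem integral_divergence {v : Pt d → Pt d} (hv : ContDiff ℝ 1 v) :
    ∫ x in s.closedInterior, divergence v x =
      ∑ j, ∫ x in facet s j, ⟪v x, normal s j⟫ ∂(surf d) := by
  have hcoord (k : Fin d) : ContDiff ℝ 1 fun x => v x k := by fun_prop
  calc ∫ x in s.closedInterior, divergence v x
      = ∑ k, ∫ x in s.closedInterior,
          fderiv ℝ (fun y => v y k) x (EuclideanSpace.single k 1) := by
        simp only [fderiv_coord (hv.differentiable one_ne_zero _), divergence]
        refine integral_finsetSum _ fun k _ => ?_
        have := hv.continuous_fderiv one_ne_zero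
        exact (by fun_prop : Continuous _).continuousOn.integrableOn_compact
          s.isCompact_closedInterior
    _ = ∑ j, ∑ k, normal s j k * ∫ x in facet s j, v x k ∂(surf d) := by
        rw [Finset.sum_comm]
        refine Finset.sum_congr rfl fun k _ => ?_
        simp [integral_fderiv_simplex s (hcoord k), EuclideanSpace.inner_single_right]
    _ = ∑ j, ∫ x in facet s j, ⟪v x, normal s j⟫ ∂(surf d) := by
        simp only [PiLp.inner_apply, RCLike.inner_apply, conj_trivial, ← integral_const_mul]
        exact Finset.sum_congr rfl fun j _ => (integral_finsetSum _ fun k _ =>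
          (integrableOn_facet s (hcoord k).continuous.continuousOn).const_mul _).symm

theorem integral_inner_gradient_add_divergence {v : Pt d → Pt d} (hv : ContDiff ℝ 1 v)
    {φ : Pt d → ℝ} (hφ : ContDiff ℝ 1 φ) :
    (∫ x in s.closedInterior, ⟪v x, gradient φ x⟫) + ∫ x in s.closedInterior, divergence v x * φ x =
      ∑ j, ∫ x in facet s j, ⟪v x, normal s j⟫ * φ x ∂(surf d) := by
  have hK := s.isCompact_closedInterior
  have hgrad := (hv.continuous.inner (𝕜 := ℝ)
    (continuous_gradient hφ)).continuousOn.integrableOn_compact (μ := volume) hK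
  have hdiv := ((continuous_divergence hv).mul hφ.continuous).continuousOn.integrableOn_compact
    (μ := volume) hK
  refine (integral_add hgrad hdiv).symm.trans ?_
  simp only [Pi.mul_apply, ← divergence_smul (hφ.differentiable one_ne_zero _)
    (hv.differentiable one_ne_zero _)]
  refine (integral_divergence s (v := fun x => φ x • v x) (hφ.smul hv)).trans ?_
  simp only [real_inner_smul_left, mul_comm (φ _)]

end DivergenceTheorem

section Polynomials

theorem totalDegree_pderiv_le {σ R : Type*} [CommSemiring R] (k : σ) (P : MvPolynomial σ R) :
    (MvPolynomial.pderiv k P).totalDegree ≤ P.totalDegree - 1 := by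
  conv_lhs => rw [P.as_sum, map_sum]
  refine MvPolynomial.totalDegree_finsetSum_le fun m hm => ?_
  rw [MvPolynomial.pderiv_monomial]
  by_cases hmk : m k = 0
  · simp [hmk]
  refine (MvPolynomial.totalDegree_monomial_le _ _).trans ?_
  have hdegree : m.degree ≤ P.totalDegree := MvPolynomial.le_totalDegree hm
  have hsplit := congrArg Finsupp.degree
    (tsub_add_cancel_of_le (Finsupp.single_le_iff.2 (Nat.one_le_iff_ne_zero.2 hmk)))
  rw [map_add, Finsupp.degree_single] at hsplit
  change (m - Finsupp.single k 1).degree ≤ _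
  omega

variable {d p q : ℕ} {f g : Pt d → ℝ} {v : Pt d → Pt d}

theorem contDiff_eval (P : MvPolynomial (Fin d) ℝ) {n : WithTop ℕ∞} :
    ContDiff ℝ n fun x : Pt d => MvPolynomial.eval (fun k => x k) P :=
  (AnalyticOnNhd.eval_mvPolynomial P).contDiff.comp (by fun_prop)

theorem fderiv_eval_single (P : MvPolynomial (Fin d) ℝ) (k : Fin d) (x : Pt d) :
    fderiv ℝ (fun x : Pt d => MvPolynomial.eval (fun k => x k) P) x (EuclideanSpace.single k 1) =
      MvPolynomial.eval (fun k => x k) (MvPolynomial.pderiv k P) := by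
  have hdiff (P : MvPolynomial (Fin d) ℝ) := (contDiff_eval P (n := 1)).differentiable one_ne_zero x
  induction P using MvPolynomial.induction_on with
  | C a => simp
  | add P Q hP hQ => simp [fderiv_fun_add (hdiff P) (hdiff Q), hP, hQ]
  | mul_X P j hP =>
    have hcoord : DifferentiableAt ℝ (fun x : Pt d => x j) x := by fun_prop
    have hfderiv : fderiv ℝ (fun x : Pt d => x j) x (EuclideanSpace.single k 1) =
        Pi.single (M := fun _ => ℝ) k 1 j := by
      rw [fderiv_coord (v := fun x => x) differentiableAt_fun_id, fderiv_fun_id]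
      rfl
    simp only [map_mul, map_add, MvPolynomial.eval_X, MvPolynomial.pderiv_mul,
      MvPolynomial.pderiv_X, fderiv_fun_mul (hdiff P) hcoord, add_apply, smul_apply, smul_eq_mul,
      hP, hfderiv]
    rcases eq_or_ne k j with rfl | hkj
    · rw [Pi.single_eq_same, Pi.single_eq_same, map_one]
      ring
    · rw [Pi.single_eq_of_ne hkj.symm, Pi.single_eq_of_ne hkj.symm, map_zero]
      ring

theorem IsPoly.contDiff (hf : IsPoly p f) {n : WithTop ℕ∞} : ContDiff ℝ n f := by
  obtain ⟨P, -, hP⟩ := hf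
  rw [funext hP]
  exact contDiff_eval P

theorem IsPoly.continuous (hf : IsPoly p f) : Continuous f :=
  (hf.contDiff (n := 0)).continuous

theorem IsPoly.mono (hf : IsPoly p f) (hpq : p ≤ q) : IsPoly q f := by
  obtain ⟨P, hP, hfP⟩ := hf
  exact ⟨P, hP.trans hpq, hfP⟩

theorem isPoly_const (c : ℝ) : IsPoly p fun _ : Pt d => c :=
  ⟨MvPolynomial.C c, by simp, by simp⟩

theorem isPoly_coord (k : Fin d) : IsPoly 1 fun x : Pt d => x k :=
  ⟨MvPolynomial.X k, by simp, by simp⟩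

theorem IsPoly.add (hf : IsPoly p f) (hg : IsPoly p g) : IsPoly p fun x => f x + g x := by
  obtain ⟨P, hP, hfP⟩ := hf
  obtain ⟨Q, hQ, hgQ⟩ := hg
  exact ⟨P + Q, (MvPolynomial.totalDegree_add _ _).trans (max_le hP hQ), by simp [hfP, hgQ]⟩

theorem IsPoly.mul (hf : IsPoly p f) (hg : IsPoly q g) : IsPoly (p + q) fun x => f x * g x := by
  obtain ⟨P, hP, hfP⟩ := hf
  obtain ⟨Q, hQ, hgQ⟩ := hg
  exact ⟨P * Q, (MvPolynomial.totalDegree_mul _ _).trans (add_le_add hP hQ), by simp [hfP, hgQ]⟩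

theorem IsPoly.sub (hf : IsPoly p f) (hg : IsPoly p g) : IsPoly p fun x => f x - g x := by
  obtain ⟨P, hP, hfP⟩ := hf
  obtain ⟨Q, hQ, hgQ⟩ := hg
  exact ⟨P - Q, (MvPolynomial.totalDegree_sub _ _).trans (max_le hP hQ), by simp [hfP, hgQ]⟩

theorem IsPoly.sum {α : Type*} (t : Finset α) {f : α → Pt d → ℝ} (hf : ∀ a ∈ t, IsPoly p (f a)) :
    IsPoly p fun x => ∑ a ∈ t, f a x := by
  choose! P hP hfP using hf
  exact ⟨∑ a ∈ t, P a, MvPolynomial.totalDegree_finsetSum_le hP,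
    fun x => by rw [map_sum]; exact Finset.sum_congr rfl fun a ha => hfP a ha x⟩

theorem IsPoly.fderiv_single (hf : IsPoly p f) (k : Fin d) :
    IsPoly (p - 1) fun x => fderiv ℝ f x (EuclideanSpace.single k 1) := by
  obtain ⟨P, hP, hfP⟩ := hf
  rw [funext hfP]
  exact ⟨MvPolynomial.pderiv k P, (totalDegree_pderiv_le k P).trans (Nat.sub_le_sub_right hP 1),
    fderiv_eval_single P k⟩

theorem IsPoly.gradient (hf : IsPoly p f) : IsPolyVec (p - 1) (gradient f) := by
  intro k
  have hcoord (x : Pt d) : _root_.gradient f x k = fderiv ℝ f x (EuclideanSpace.single k 1) := by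
    rw [← InnerProductSpace.toDual_symm_apply, EuclideanSpace.inner_single_right]
    simp [_root_.gradient]
  simpa only [hcoord] using hf.fderiv_single k

theorem IsPoly.gradient_eq_zero (hf : IsPoly 0 f) (x : Pt d) : _root_.gradient f x = 0 := by
  obtain ⟨P, hP, hfP⟩ := hf
  obtain ⟨c, rfl⟩ : ∃ c, P = MvPolynomial.C c :=
    ⟨_, MvPolynomial.totalDegree_eq_zero_iff_eq_C.1 (Nat.le_zero.1 hP)⟩
  simp [funext hfP]

theorem IsPolyVec.contDiff (hv : IsPolyVec p v) {n : WithTop ℕ∞} : ContDiff ℝ n v :=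
  contDiff_euclidean.2 fun k => (hv k).contDiff

theorem IsPolyVec.divergence (hv : IsPolyVec p v) : IsPoly (p - 1) (divergence v) := by
  have hdiff := (hv.contDiff (n := 1)).differentiable one_ne_zero
  unfold HDG.divergence
  simp only [← fderiv_coord (hdiff _)]
  exact IsPoly.sum _ fun k _ => (hv k).fderiv_single k

theorem IsPolyVec.inner_const (hv : IsPolyVec p v) (n : Pt d) : IsPoly p fun x => ⟪v x, n⟫ := by
  simp only [PiLp.inner_apply, RCLike.inner_apply, conj_trivial]
  exact IsPoly.sum _ fun k _ => ((isPoly_const (p := 0) (n k)).mul (hv k)).mono (zero_add p).le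

theorem IsRaviartThomas.isPolyVec (hv : IsRaviartThomas p v) : IsPolyVec (p + 1) v := by
  obtain ⟨a, b, ha, hb, hab⟩ := hv
  intro k
  simp only [hab, PiLp.add_apply, PiLp.smul_apply, smul_eq_mul]
  exact ((ha k).mono p.le_succ).add (hb.mul (isPoly_coord k))

theorem isPoly_l2Proj (μ : Measure (Pt d)) (p : ℕ) (g : Pt d → ℝ) : IsPoly p (l2Proj μ p g) := by
  unfold l2Proj
  split_ifs with h
  · exact h.choose_spec.1
  · exact isPoly_const 0

/-- `f|_S ∈ ℙ^p(S)`: on the set `S`, the function `f` is a polynomial of degree at most `p`. -/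
def IsPolyOn (p : ℕ) (S : Set (Pt d)) (f : Pt d → ℝ) : Prop :=
  ∃ π, IsPoly p π ∧ Set.EqOn f π S

theorem IsPoly.isPolyOn (hf : IsPoly p f) (S : Set (Pt d)) : IsPolyOn p S f :=
  ⟨f, hf, Set.eqOn_refl f S⟩

/- On the hyperplane the factor `⟪x, n⟫` of the summand `x ℙ^p` is constant, so that the normal
component loses one degree. -/
theorem IsRaviartThomas.isPolyOn_hyperplane (hv : IsRaviartThomas p v) (n a : Pt d) :
    IsPolyOn p (hyperplane n a) fun x => ⟪v x, n⟫ := by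
  obtain ⟨b, c, hb, hc, hbc⟩ := hv
  refine ⟨_, (hb.inner_const n).add ((hc.mul (isPoly_const ⟪a, n⟫)).mono (add_zero p).le),
    fun x hx => ?_⟩
  have hxa : ⟪x, n⟫ = ⟪a, n⟫ := by
    rwa [hyperplane, Set.mem_ofPred_eq, inner_sub_right, sub_eq_zero, real_inner_comm,
      real_inner_comm a] at hx
  simp only [hbc, inner_add_left, real_inner_smul_left, hxa]

end Polynomials

section FacetPolynomials

variable {d : ℕ} [d.AtLeastTwo] {s : Affine.Simplex ℝ (Pt d) d} {j : Fin (d + 1)} {p : ℕ}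
  {f g : Pt d → ℝ}

theorem IsPolyOn.eqOn_facet (hf : IsPolyOn p (facet s j) f) (hg : IsPolyOn p (facet s j) g)
    (hfg : ∀ w, IsPoly p w →
      ∫ x in facet s j, f x * w x ∂(surf d) = ∫ x in facet s j, g x * w x ∂(surf d)) :
    Set.EqOn f g (facet s j) := by
  obtain ⟨P, hP, hfP⟩ := hf
  obtain ⟨Q, hQ, hgQ⟩ := hg
  have hmeas := (isCompact_facet s j).measurableSet
  have hPQ := hP.sub hQ
  have hint {w : Pt d → ℝ} (hw : Continuous w) :
      IntegrableOn (fun x => w x * (P x - Q x)) (facet s j) (surf d) :=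
    integrableOn_facet s (hw.mul hPQ.continuous).continuousOn
  have hzero : ∫ x in facet s j, (P x - Q x) * (P x - Q x) ∂(surf d) = 0 := by
    simp only [sub_mul _ _ (P _ - Q _)]
    rw [integral_sub (hint hP.continuous) (hint hQ.continuous), sub_eq_zero,
      ← setIntegral_congr_fun hmeas fun x hx => congrArg (· * (P x - Q x)) (hfP hx),
      ← setIntegral_congr_fun hmeas fun x hx => congrArg (· * (P x - Q x)) (hgQ hx)]
    exact hfg _ hPQ
  rw [integral_eq_zero_iff_of_nonneg (fun x => mul_self_nonneg _) (hint hPQ.continuous)] at hzero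
  have hae : P =ᵐ[(surf d).restrict (facet s j)] Q := by
    filter_upwards [hzero] with x hx using sub_eq_zero.1 (mul_self_eq_zero.1 hx)
  exact hfP.trans ((eqOn_facet_of_ae_eq s hP.continuous hQ.continuous hae).trans hgQ.symm)

theorem IsRaviartThomas.isPolyOn_facet {v : Pt d → Pt d} (hv : IsRaviartThomas p v) :
    IsPolyOn p (facet s j) fun x => ⟪v x, normal s j⟫ := by
  obtain ⟨π, hπ, hvπ⟩ := hv.isPolyOn_hyperplane (normal s j) (s.altitudeFoot j)
  exact ⟨π, hπ, hvπ.mono (facet_subset_facetPlane s)⟩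

end FacetPolynomials

section CommonFacets

variable {d : ℕ}

theorem affineMap_apply_eq_sum_bary (s : Affine.Simplex ℝ (Pt d) d) (f : Pt d →ᵃ[ℝ] ℝ) (x : Pt d) :
    f x = ∑ k, bary s k x * f (s.points k) := by
  conv_lhs => rw [← affineCombination_bary s x]
  rw [Finset.map_affineCombination _ _ _ (sum_bary s x),
    Finset.affineCombination_eq_linear_combination _ _ _ (sum_bary s x)]
  rfl

variable [NeZero d] {s s' : Affine.Simplex ℝ (Pt d) d} {j j' : Fin (d + 1)}

theorem bary_lineMap_point {x : Pt d} (hx : x ∈ facet s j) (t : ℝ) :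
    bary s j (AffineMap.lineMap x (s.points j) t) = t := by
  simp [AffineMap.apply_lineMap, bary_point, AffineMap.lineMap_apply_ring,
    ((mem_facet_iff s).1 hx).1]

theorem bary_eq_smul_of_facet_eq (h : facet s j = facet s' j') :
    bary s' j' = bary s' j' (s.points j) • bary s j := by
  ext x
  rw [affineMap_apply_eq_sum_bary s, Finset.sum_eq_single j _ (by simp), mul_comm]
  · rfl
  · intro k _ hkj
    have hk : s.points k ∈ facet s j := s.point_mem_closedInterior_faceOpposite_iff.2 hkj
    rw [((mem_facet_iff s').1 (h ▸ hk)).1, mul_zero]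

theorem exists_facet_eq_of_image_subset (h : s.points '' {j}ᶜ ⊆ Set.range s'.points) :
    ∃ j', facet s j = facet s' j' := by
  have hcard (s : Affine.Simplex ℝ (Pt d) d) (j : Fin (d + 1)) :
      (s.points '' {j}ᶜ).ncard = d := by
    rw [Set.ncard_image_of_injective _ s.independent.injective, Set.ncard_compl]
    simp
  obtain ⟨_, ⟨j', rfl⟩, hj'⟩ : ∃ x ∈ Set.range s'.points, x ∉ s.points '' {j}ᶜ := by
    refine Set.exists_mem_notMem_of_ncard_lt_ncard ?_
    rw [hcard, Set.ncard_range_of_injective s'.independent.injective]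
    simp
  have hsubset : s.points '' {j}ᶜ ⊆ s'.points '' {j'}ᶜ := by
    intro x hx
    obtain ⟨k, rfl⟩ := h hx
    exact ⟨k, fun hk => hj' (hk ▸ hx), rfl⟩
  refine ⟨j', ?_⟩
  rw [facet_eq_convexHull, facet_eq_convexHull,
    Set.eq_of_subset_of_ncard_le hsubset (by rw [hcard, hcard])]

end CommonFacets

section OppositeSides

variable {d : ℕ} [d.AtLeastTwo] {s s' : Affine.Simplex ℝ (Pt d) d} {j j' : Fin (d + 1)}

theorem image_compl_subset_of_mem_convexHull {x : Pt d} (hx : x ∈ openFacet s j) {T : Set (Pt d)}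
    (hxT : x ∈ convexHull ℝ (Set.range s.points ∩ T)) : s.points '' {j}ᶜ ⊆ T := by
  rintro _ ⟨k, hkj, rfl⟩
  by_contra hkT
  have hconv : Convex ℝ (bary s k ⁻¹' {0}) := (convex_singleton 0).affine_preimage (bary s k)
  refine (((mem_openFacet_iff s).1 hx).2 k hkj).ne' (convexHull_min ?_ hconv hxT)
  rintro _ ⟨⟨l, rfl⟩, hlT⟩
  have hkl : k ≠ l := fun h => hkT (h ▸ hlT)
  simp [bary_point, hkl]

theorem bary_point_nonpos_of_facet_eq (h : facet s j = facet s' j')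
    (hdisj : Disjoint s.interior s'.interior) : bary s' j' (s.points j) ≤ 0 := by
  by_contra! hpos
  obtain ⟨x, hx⟩ := nonempty_openFacet s (j := j)
  have hx' : x ∈ closure (openFacet s' j') :=
    facet_subset_closure_openFacet s' (h ▸ openFacet_subset_facet s hx)
  obtain ⟨y, hy', hy⟩ := ((mem_closure_iff_frequently.1 hx').and_eventually
    (eventually_eventually_nhds.2 (eventually_mem_interior_of_mem_openFacet s hx))).exists
  have hyj : y ∈ facet s j := h ▸ openFacet_subset_facet s' hy'
  have htendsto : Filter.Tendsto (fun t : ℝ => AffineMap.lineMap y (s.points j) t)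
      (nhdsWithin 0 (Set.Ioi 0)) (nhds y) :=
    (AffineMap.lineMap_continuous.tendsto' 0 y (by simp)).mono_left nhdsWithin_le_nhds
  obtain ⟨t, ⟨hint, hint'⟩, ht⟩ := ((htendsto.eventually
    (hy.and (eventually_mem_interior_of_mem_openFacet s' hy'))).and self_mem_nhdsWithin).exists
  have hbary : 0 < bary s j (AffineMap.lineMap y (s.points j) t) := by
    rwa [bary_lineMap_point hyj]
  refine Set.disjoint_left.1 hdisj (hint hbary) (hint' ?_)
  rw [bary_eq_smul_of_facet_eq h]
  exact mul_pos hpos hbary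

theorem normal_eq_neg_of_facet_eq (h : facet s j = facet s' j')
    (hdisj : Disjoint s.interior s'.interior) : normal s' j' = -normal s j := by
  set r := s'.height j' * bary s' j' (s.points j) / s.height j with hr
  have hnormal : normal s' j' = r • normal s j := by
    refine ext_inner_right ℝ fun v => ?_
    rw [real_inner_smul_left, inner_normal_eq, inner_normal_eq, bary_eq_smul_of_facet_eq h,
      AffineMap.smul_linear, LinearMap.smul_apply, smul_eq_mul, hr]
    have := (s.height_pos j).ne'
    field_simp
  have hr_nonpos : r ≤ 0 := div_nonpos_of_nonpos_of_nonneg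
    (mul_nonpos_of_nonneg_of_nonpos (s'.height_pos j').le (bary_point_nonpos_of_facet_eq h hdisj))
    (s.height_pos j).le
  have hnorm := congrArg norm hnormal
  rw [norm_smul, norm_normal, norm_normal, mul_one, Real.norm_eq_abs, abs_of_nonpos hr_nonpos]
    at hnorm
  rw [hnormal, neg_eq_iff_eq_neg.1 hnorm.symm, neg_one_smul]

end OppositeSides

section InteriorFacets

variable {ι : Type*} {i i' i₁ i₂ : ι}

theorem IsMesh.closedInterior_subset {d : ℕ} {Ω : Set (Pt d)} {K : ι → Affine.Simplex ℝ (Pt d) d}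
    (hK : IsMesh Ω K) (i : ι) : (K i).closedInterior ⊆ closure Ω :=
  hK.cover ▸ Set.subset_iUnion (fun i => (K i).closedInterior) i

theorem IsInteriorFacet.symm {d : ℕ} [NeZero d] {K : ι → Affine.Simplex ℝ (Pt d) d}
    {j j' : Fin (d + 1)} (h : IsInteriorFacet K i j i' j') : IsInteriorFacet K i' j' i j :=
  ⟨h.1.symm, h.2.symm⟩

variable {d : ℕ} [d.AtLeastTwo] {Ω : Set (Pt d)} {K : ι → Affine.Simplex ℝ (Pt d) d}
  {j j' j₁ j₂ : Fin (d + 1)}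

theorem IsMesh.normal_eq_neg (hK : IsMesh Ω K) (h : IsInteriorFacet K i j i' j') :
    normal (K i') j' = -normal (K i) j :=
  normal_eq_neg_of_facet_eq h.2 (hK.nonoverlapping i i' h.1)

theorem IsMesh.interiorFacet_unique (hK : IsMesh Ω K) (h₁ : IsInteriorFacet K i j i₁ j₁)
    (h₂ : IsInteriorFacet K i j i₂ j₂) : i₁ = i₂ ∧ j₁ = j₂ := by
  have hfacet := h₁.2.symm.trans h₂.2
  obtain rfl : i₁ = i₂ := by
    by_contra hne
    have : IsAddTorsionFree (Pt d) := .of_isTorsionFree ℝ _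
    have hself := hK.normal_eq_neg ⟨hne, hfacet⟩
    rw [hK.normal_eq_neg h₁, hK.normal_eq_neg h₂, neg_neg, neg_eq_self, ← norm_eq_zero,
      norm_normal] at hself
    exact one_ne_zero hself
  exact ⟨rfl, facet_injective _ hfacet⟩

theorem IsMesh.exists_ne_mem_closedInterior [Finite ι] (hΩ : IsOpen Ω) (hK : IsMesh Ω K) {x : Pt d}
    (hxΩ : x ∈ Ω) (hx : x ∈ facet (K i) j) : ∃ i', i ≠ i' ∧ x ∈ (K i').closedInterior := by
  have htendsto : Filter.Tendsto (fun t : ℝ => AffineMap.lineMap x ((K i).points j) t)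
      (nhdsWithin 0 (Set.Iio 0)) (nhds x) :=
    (AffineMap.lineMap_continuous.tendsto' 0 x (by simp)).mono_left nhdsWithin_le_nhds
  have hcover : ∀ᶠ t : ℝ in nhdsWithin 0 (Set.Iio 0),
      ∃ i', AffineMap.lineMap x ((K i).points j) t ∈ (K i').closedInterior := by
    filter_upwards [htendsto.eventually (hΩ.mem_nhds hxΩ)] with t ht
    exact Set.mem_iUnion.1 (hK.cover.symm ▸ subset_closure ht)
  obtain ⟨i', hi'⟩ := Filter.frequently_exists.1 hcover.frequently
  refine ⟨i', ?_, (K i').isClosed_closedInterior.mem_of_frequently_of_tendsto hi' htendsto⟩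
  rintro rfl
  obtain ⟨t, htK, ht⟩ := (hi'.and_eventually self_mem_nhdsWithin).exists
  have hbary := (mem_closedInterior_iff _).1 htK j
  rw [bary_lineMap_point hx] at hbary
  exact hbary.not_gt ht

theorem IsMesh.exists_isInteriorFacet [Finite ι] (hΩ : IsOpen Ω) (hK : IsMesh Ω K)
    (h : ¬ facet (K i) j ⊆ frontier Ω) : ∃ i' j', IsInteriorFacet K i j i' j' := by
  obtain ⟨y, hy, hyfrontier⟩ := Set.not_subset.1 h
  have hyΩ : y ∈ Ω := by
    rw [hΩ.frontier_eq] at hyfrontier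
    by_contra hyΩ
    exact hyfrontier ⟨hK.closedInterior_subset i (facet_subset_closedInterior _ j hy), hyΩ⟩
  obtain ⟨x, hxΩ, hx⟩ := mem_closure_iff.1 (facet_subset_closure_openFacet _ hy) Ω hΩ hyΩ
  have hxfacet := openFacet_subset_facet _ hx
  obtain ⟨i', hne, hxi'⟩ := hK.exists_ne_mem_closedInterior hΩ hxΩ hxfacet
  have hxhull : x ∈ convexHull ℝ (Set.range (K i).points ∩ Set.range (K i').points) :=
    hK.conforming i i' hne ▸ ⟨facet_subset_closedInterior _ j hxfacet, hxi'⟩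
  obtain ⟨j', hj'⟩ :=
    exists_facet_eq_of_image_subset (image_compl_subset_of_mem_convexHull hx hxhull)
  exact ⟨i', j', hne, hj'⟩

end InteriorFacets

section Projections

theorem memLp_restrict_of_isCompact {X E : Type*} [TopologicalSpace X] [MeasurableSpace X]
    [OpensMeasurableSpace X] [T2Space X] [NormedAddCommGroup E] {μ : Measure X} {k : Set X}
    (hk : IsCompact k) (hμk : μ k ≠ ⊤) {f : X → E} (hf : ContinuousOn f k) {r : ENNReal} :
    MemLp f r (μ.restrict k) := by
  have := isFiniteMeasure_restrict.2 hμk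
  obtain ⟨C, hC⟩ := hk.exists_bound_of_continuousOn hf
  exact MemLp.of_bound (hf.aestronglyMeasurable_of_isCompact hk hk.measurableSet) C
    (ae_restrict_of_forall_mem hk.measurableSet hC)

theorem memLp_restrict_closedInterior {d : ℕ} (s : Affine.Simplex ℝ (Pt d) d) {E : Type*}
    [NormedAddCommGroup E] {f : Pt d → E} (hf : ContinuousOn f s.closedInterior) {r : ENNReal} :
    MemLp f r (volume.restrict s.closedInterior) :=
  memLp_restrict_of_isCompact s.isCompact_closedInterior
    s.isCompact_closedInterior.measure_lt_top.ne hf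

theorem memLp_restrict_facet {d : ℕ} [NeZero d] (s : Affine.Simplex ℝ (Pt d) d) {j : Fin (d + 1)}
    {E : Type*} [NormedAddCommGroup E] {f : Pt d → E} (hf : ContinuousOn f (facet s j))
    {r : ENNReal} : MemLp f r ((surf d).restrict (facet s j)) :=
  memLp_restrict_of_isCompact (isCompact_facet s j) (isFiniteMeasure_restrict.1 inferInstance) hf

variable {d p : ℕ} {μ : Measure (Pt d)} {g π w : Pt d → ℝ}

theorem isL2Proj_iff (hμ : ∀ w, IsPoly p w → MemLp w 2 μ) (hg : MemLp g 2 μ) :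
    IsL2Proj μ p g π ↔
      IsPoly p π ∧ ∀ w, IsPoly p w → ∫ x, π x * w x ∂μ = ∫ x, g x * w x ∂μ := by
  refine and_congr_right fun hπ => forall₂_congr fun w hw => ?_
  have hgw : Integrable (fun x => g x * w x) μ := hg.integrable_mul (hμ w hw)
  have hπw : Integrable (fun x => π x * w x) μ := (hμ π hπ).integrable_mul (hμ w hw)
  simp only [sub_mul]
  rw [integral_sub hgw hπw, sub_eq_zero, eq_comm]

theorem integral_l2Proj_mul (hμ : ∀ w, IsPoly p w → MemLp w 2 μ) (hg : MemLp g 2 μ)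
    (hw : IsPoly p w) : ∫ x, l2Proj μ p g x * w x ∂μ = ∫ x, g x * w x ∂μ :=
  ((isL2Proj_iff hμ hg).1 (l2Proj_spec μ p g hμ hg)).2 w hw

end Projections

section WeakDivergence

variable {d : ℕ} {Ω : Set (Pt d)}

theorem HasWeakDiv.ae_eq (hΩ : IsOpen Ω) {v : Pt d → Pt d} {g₁ g₂ : Pt d → ℝ}
    (h₁ : HasWeakDiv Ω v g₁) (h₂ : HasWeakDiv Ω v g₂) : g₁ =ᵐ[volume.restrict Ω] g₂ := by
  have hloc : LocallyIntegrableOn (g₁ - g₂) Ω volume :=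
    locallyIntegrableOn_of_locallyIntegrable_restrict
      ((h₁.1.sub h₂.1).locallyIntegrable one_le_two)
  have hzero := hΩ.ae_eq_zero_of_integral_contDiff_smul_eq_zero hloc fun φ hφ hc hs => by
    have hφ2 : MemLp φ 2 (volume.restrict Ω) :=
      (hφ.continuous.memLp_of_hasCompactSupport hc).restrict Ω
    have hgφ₁ : Integrable (fun x => g₁ x * φ x) (volume.restrict Ω) := h₁.1.integrable_mul hφ2
    have hgφ₂ : Integrable (fun x => g₂ x * φ x) (volume.restrict Ω) := h₂.1.integrable_mul hφ2
    have hφ0 {x : Pt d} (hx : x ∉ Ω) : φ x • (g₁ - g₂) x = 0 := by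
      rw [image_eq_zero_of_notMem_tsupport fun h => hx (hs h), zero_smul]
    rw [← setIntegral_eq_integral_of_forall_compl_eq_zero (s := Ω) fun _ => hφ0]
    calc ∫ x in Ω, φ x • (g₁ - g₂) x
        = ∫ x in Ω, g₁ x * φ x - g₂ x * φ x := by
          simp only [Pi.sub_apply, smul_eq_mul, mul_sub, mul_comm]
      _ = (∫ x in Ω, g₁ x * φ x) - ∫ x in Ω, g₂ x * φ x := integral_sub hgφ₁ hgφ₂
      _ = 0 := sub_eq_zero.2 (neg_injective ((h₁.2 φ hφ hc hs).symm.trans (h₂.2 φ hφ hc hs)))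
  rw [Filter.EventuallyEq, ae_restrict_iff' hΩ.measurableSet]
  filter_upwards [hzero] with x hx hxΩ
  exact sub_eq_zero.1 (hx hxΩ)

end WeakDivergence

section BrokenFields

variable {ι : Type*}

theorem IsMesh.sum_indicator_interior {d : ℕ} {Ω : Set (Pt d)} {K : ι → Affine.Simplex ℝ (Pt d) d}
    [Fintype ι] (hK : IsMesh Ω K) {E : Type*} [AddCommMonoid E] (F : ι → Pt d → E) {i : ι}
    {x : Pt d} (hx : x ∈ (K i).interior) :
    ∑ i', (K i').interior.indicator (F i') x = F i x := by
  rw [Finset.sum_eq_single_of_mem i (Finset.mem_univ i), Set.indicator_of_mem hx]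
  intro i' _ hne
  exact Set.indicator_of_notMem
    (Set.disjoint_right.1 (hK.nonoverlapping i' i hne) hx) _

variable {d : ℕ} [NeZero d] {Ω : Set (Pt d)} {K : ι → Affine.Simplex ℝ (Pt d) d}

theorem IsMesh.interior_subset (hΩreg : interior (closure Ω) = Ω) (hK : IsMesh Ω K) (i : ι) :
    (K i).interior ⊆ Ω := by
  rw [← hΩreg, ← interior_closedInterior]
  exact interior_mono (hK.closedInterior_subset i)

theorem IsMesh.restrict_closedInterior_le (hΩreg : interior (closure Ω) = Ω) (hK : IsMesh Ω K)
    (i : ι) : volume.restrict (K i).closedInterior ≤ volume.restrict Ω := by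
  rw [← Measure.restrict_congr_set (interior_ae_eq_closedInterior (K i))]
  exact Measure.restrict_mono_set _ (hK.interior_subset hΩreg i)

variable [Fintype ι]

theorem memLp_sum_indicator_interior {E : Type*} [NormedAddCommGroup E] {F : ι → Pt d → E}
    (hF : ∀ i, Continuous (F i)) {r : ENNReal} :
    MemLp (fun x => ∑ i, (K i).interior.indicator (F i) x) r volume := by
  refine memLp_finsetSum _ fun i _ => ?_
  rw [memLp_indicator_iff_restrict (isOpen_simplexInterior _).measurableSet,
    Measure.restrict_congr_set (interior_ae_eq_closedInterior _)]
  exact memLp_restrict_closedInterior _ (hF i).continuousOn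

theorem IsMesh.integral_sum_indicator_interior (hΩreg : interior (closure Ω) = Ω)
    (hK : IsMesh Ω K) {F : ι → Pt d → ℝ} (hF : ∀ i, IntegrableOn (F i) (K i).closedInterior) :
    ∫ x in Ω, ∑ i, (K i).interior.indicator (F i) x = ∑ i, ∫ x in (K i).closedInterior, F i x := by
  have hmeas (i : ι) : MeasurableSet (K i).interior := (isOpen_simplexInterior _).measurableSet
  have hae (i : ι) := interior_ae_eq_closedInterior (K i)
  rw [integral_finsetSum]
  · refine Finset.sum_congr rfl fun i _ => ?_
    rw [setIntegral_indicator (hmeas i), Set.inter_eq_right.2 (hK.interior_subset hΩreg i),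
      setIntegral_congr_set (hae i)]
  · intro i _
    exact (((hF i).congr_set_ae (hae i)).integrable_indicator (hmeas i)).restrict

end BrokenFields

section Gluing

variable {d : ℕ} {ι : Type*} {Ω : Set (Pt d)} {K : ι → Affine.Simplex ℝ (Pt d) d}

/-- The normal component of the broken field `σ` is single-valued on interior facets. -/
def IsNormalContinuous [NeZero d] (K : ι → Affine.Simplex ℝ (Pt d) d) (σ : ι → Pt d → Pt d) :
    Prop :=
  ∀ i j i' j', IsInteriorFacet K i j i' j' →
    Set.EqOn (fun x => ⟪σ i x, normal (K i) j⟫) (fun x => ⟪σ i' x, normal (K i) j⟫) (facet (K i) j)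

variable [d.AtLeastTwo] [Fintype ι] {σ : ι → Pt d → Pt d}

theorem IsMesh.sum_facets_eq_zero (hΩ : IsOpen Ω) (hK : IsMesh Ω K) {A : Type*} [AddCommMonoid A]
    {F : ι → Fin (d + 1) → A}
    (hinterior : ∀ i j i' j', IsInteriorFacet K i j i' j' → F i j + F i' j' = 0)
    (hboundary : ∀ i j, facet (K i) j ⊆ frontier Ω → F i j = 0) : ∑ i, ∑ j, F i j = 0 := by
  classical
  have hpartner (a : ι × Fin (d + 1)) (ha : F a.1 a.2 ≠ 0) :
      ∃ b : ι × Fin (d + 1), IsInteriorFacet K a.1 a.2 b.1 b.2 := by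
    obtain ⟨i', j', h⟩ := hK.exists_isInteriorFacet hΩ (mt (hboundary a.1 a.2) ha)
    exact ⟨(i', j'), h⟩
  choose! partner hpartner using hpartner
  rw [← Fintype.sum_prod_type', ← Finset.sum_filter_ne_zero]
  have hsum {a : ι × Fin (d + 1)} (ha : F a.1 a.2 ≠ 0) :=
    hinterior _ _ _ _ (hpartner a ha)
  have hne {a : ι × Fin (d + 1)} (ha : F a.1 a.2 ≠ 0) :
      F (partner a).1 (partner a).2 ≠ 0 := fun h => ha (by simpa [h] using hsum ha)
  refine Finset.sum_involution (fun a _ => partner a) ?_ ?_ ?_ ?_ <;>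
    simp only [Finset.mem_filter_univ]
  · exact fun a ha => hsum ha
  · exact fun a ha _ h => (hpartner a ha).1 (congrArg Prod.fst h).symm
  · exact fun a ha => hne ha
  · intro a ha
    obtain ⟨hi, hj⟩ := hK.interiorFacet_unique (hpartner _ (hne ha)) (hpartner a ha).symm
    exact Prod.ext hi hj

theorem IsNormalContinuous.sum_integral_facet_mul_eq_zero (hΩ : IsOpen Ω) (hK : IsMesh Ω K)
    (hσ : IsNormalContinuous K σ) {φ : Pt d → ℝ} (hφ : Set.EqOn φ 0 (frontier Ω)) :
    ∑ i, ∑ j, ∫ x in facet (K i) j, ⟪σ i x, normal (K i) j⟫ * φ x ∂(surf d) = 0 := by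
  refine hK.sum_facets_eq_zero hΩ (fun i j i' j' h => ?_) fun i j hfacet => ?_
  · rw [← h.2, hK.normal_eq_neg h, add_eq_zero_iff_eq_neg, ← integral_neg]
    refine setIntegral_congr_fun (isCompact_facet _ j).measurableSet fun x hx => ?_
    have hx := hσ i j i' j' h hx
    simp only [inner_neg_right, neg_mul, neg_neg] at hx ⊢
    rw [hx]
  · refine setIntegral_eq_zero_of_forall_eq_zero fun x hx => ?_
    rw [hφ (hfacet hx), Pi.zero_apply, mul_zero]

theorem IsNormalContinuous.hasWeakDiv_glue (hΩ : IsOpen Ω) (hΩreg : interior (closure Ω) = Ω)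
    (hK : IsMesh Ω K) (hσ : IsNormalContinuous K σ) (hσC : ∀ i, ContDiff ℝ 1 (σ i)) :
    HasWeakDiv Ω (glue K σ) fun x => ∑ i, (K i).interior.indicator (divergence (σ i)) x := by
  have hdiv (i : ι) := continuous_divergence (hσC i)
  refine ⟨(memLp_sum_indicator_interior hdiv).restrict Ω, fun φ hφ _ hs => ?_⟩
  have hφ1 : ContDiff ℝ 1 φ := hφ.of_le (by norm_cast)
  have hφ0 : Set.EqOn φ 0 (frontier Ω) := fun x hx =>
    image_eq_zero_of_notMem_tsupport fun h => (hΩ.frontier_eq ▸ hx).2 (hs h)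
  have hinner (x : Pt d) : ⟪glue K σ x, gradient φ x⟫ =
      ∑ i, (K i).interior.indicator (fun x => ⟪σ i x, gradient φ x⟫) x := by
    rw [glue, sum_inner]
    refine Finset.sum_congr rfl fun i _ => ?_
    by_cases hx : x ∈ (K i).interior <;> simp [hx]
  have hint {F : ι → Pt d → ℝ} (hF : ∀ i, Continuous (F i)) (i : ι) :
      IntegrableOn (F i) (K i).closedInterior :=
    (hF i).continuousOn.integrableOn_compact (K i).isCompact_closedInterior
  simp only [hinner, Finset.sum_mul, ← Set.indicator_mul_left]
  rw [hK.integral_sum_indicator_interior hΩreg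
      (hint fun i => (hσC i).continuous.inner (continuous_gradient hφ1)),
    hK.integral_sum_indicator_interior hΩreg (F := fun i x => divergence (σ i) x * φ x)
      (hint fun i => (hdiv i).mul hφ.continuous),
    eq_neg_iff_add_eq_zero, ← Finset.sum_add_distrib]
  simp only [integral_inner_gradient_add_divergence _ (hσC _) hφ1]
  exact hσ.sum_integral_facet_mul_eq_zero hΩ hK hφ0

theorem IsNormalContinuous.memHDiv_glue (hΩ : IsOpen Ω) (hΩreg : interior (closure Ω) = Ω)
    (hK : IsMesh Ω K) (hσ : IsNormalContinuous K σ) (hσC : ∀ i, ContDiff ℝ 1 (σ i)) :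
    MemHDiv Ω (glue K σ) :=
  ⟨(memLp_sum_indicator_interior fun i => (hσC i).continuous).restrict Ω, _,
    hσ.hasWeakDiv_glue hΩ hΩreg hK hσC⟩

theorem IsNormalContinuous.ae_eq_divergence (hΩ : IsOpen Ω) (hΩreg : interior (closure Ω) = Ω)
    (hK : IsMesh Ω K) (hσ : IsNormalContinuous K σ) (hσC : ∀ i, ContDiff ℝ 1 (σ i))
    {g : Pt d → ℝ} (hg : HasWeakDiv Ω (glue K σ) g) (i : ι) :
    g =ᵐ[volume.restrict (K i).closedInterior] divergence (σ i) := by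
  have hae := hg.ae_eq hΩ (hσ.hasWeakDiv_glue hΩ hΩreg hK hσC)
  rw [← Measure.restrict_congr_set (interior_ae_eq_closedInterior (K i))]
  filter_upwards [ae_restrict_of_ae_restrict_of_subset (hK.interior_subset hΩreg i) hae,
    ae_restrict_mem (isOpen_simplexInterior (K i)).measurableSet] with x hx hxi
  rw [hx, hK.sum_indicator_interior _ hxi]

end Gluing

section ConservativeFlux

/-- A flux approximation that is locally conservative: `q i` is the flux in the element `K i`, and
`qhat i j` is its numerical trace on the facet `j` of `K i`, of which only the normal component
matters. The trace is single-valued on interior facets and equal to `gN` on Neumann facets as far as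
moments of degree `p` can tell, and it balances the source `f` in each element. -/
structure IsConservativeFlux {d : ℕ} [NeZero d] {ι : Type*} (Ω ΓN : Set (Pt d))
    (K : ι → Affine.Simplex ℝ (Pt d) d) (p : ℕ) (f gN : Pt d → ℝ) (q : ι → Pt d → Pt d)
    (qhat : ι → Fin (d + 1) → Pt d → Pt d) : Prop where
  continuous : ∀ i, Continuous (q i)
  integrableOn_normal : ∀ i j,
    IntegrableOn (fun x => ⟪qhat i j x, normal (K i) j⟫) (facet (K i) j) (surf d)
  transmission : ∀ i j i' j', IsInteriorFacet K i j i' j' → ∀ w, IsPoly p w →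
    (∫ x in facet (K i) j, ⟪qhat i j x, normal (K i) j⟫ * w x ∂(surf d)) +
      ∫ x in facet (K i') j', ⟪qhat i' j' x, normal (K i') j'⟫ * w x ∂(surf d) = 0
  neumann : ∀ i j, IsBoundaryFacet Ω ΓN (K i) j → ∀ w, IsPoly p w →
    ∫ x in facet (K i) j, ⟪qhat i j x, normal (K i) j⟫ * w x ∂(surf d) =
      ∫ x in facet (K i) j, gN x * w x ∂(surf d)
  balance : ∀ i w, IsPoly p w →
    -(∫ x in (K i).closedInterior, ⟪q i x, gradient w x⟫) +
        ∑ j, ∫ x in facet (K i) j, ⟪qhat i j x, normal (K i) j⟫ * w x ∂(surf d) =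
      ∫ x in (K i).closedInterior, f x * w x

variable {d : ℕ} [d.AtLeastTwo] {Ω ΓN : Set (Pt d)} {p : ℕ} {gN w : Pt d → ℝ}

theorem IsBoundaryFacet.memLp {s : Affine.Simplex ℝ (Pt d) d} {j : Fin (d + 1)}
    (h : IsBoundaryFacet Ω ΓN s j) {g : Pt d → ℝ} {r : ENNReal}
    (hg : MemLp g r ((surf d).restrict ΓN)) : MemLp g r ((surf d).restrict (facet s j)) := by
  rw [← Measure.restrict_congr_set (openFacet_ae_eq_facet s)]
  exact hg.mono_measure (Measure.restrict_mono_set _ h.2)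

theorem IsBoundaryFacet.integral_projFacet_mul {s : Affine.Simplex ℝ (Pt d) d} {j : Fin (d + 1)}
    (h : IsBoundaryFacet Ω ΓN s j) (hgN : MemLp gN 2 ((surf d).restrict ΓN)) (hw : IsPoly p w) :
    ∫ x in facet s j, projFacet s j p gN x * w x ∂(surf d) =
      ∫ x in facet s j, gN x * w x ∂(surf d) :=
  integral_l2Proj_mul (fun _ hw => memLp_restrict_facet s hw.continuous.continuousOn)
    (h.memLp hgN) hw

end ConservativeFlux

section NumericalFlux

theorem integrableOn_facet_bdd_mul {d : ℕ} [NeZero d] (s : Affine.Simplex ℝ (Pt d) d)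
    {j : Fin (d + 1)} {g h : Pt d → ℝ} (hg : Measurable g) {C : ℝ}
    (hC : ∀ x ∈ facet s j, ‖g x‖ ≤ C) (hh : ContinuousOn h (facet s j)) :
    IntegrableOn (fun x => g x * h x) (facet s j) (surf d) :=
  (integrableOn_facet s hh).bdd_mul hg.aestronglyMeasurable
    (ae_restrict_of_forall_mem (isCompact_facet s j).measurableSet hC)

variable {d : ℕ} [NeZero d] {ι : Type*} {Ω ΓD ΓN : Set (Pt d)}
  {K : ι → Affine.Simplex ℝ (Pt d) d} {p : ℕ} {ν f gD gN : Pt d → ℝ}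
  {τ : ι → Fin (d + 1) → Pt d → ℝ} {u : ι → Pt d → ℝ} {q : ι → Pt d → Pt d}
  {uhat : ι → Fin (d + 1) → Pt d → ℝ} {qhat : ι → Fin (d + 1) → Pt d → Pt d}
  {i i' : ι} {j j' : Fin (d + 1)}

theorem IsHDGSolution.qhat_eq (hHDG : IsHDGSolution Ω ΓD ΓN K p ν f gD gN τ u q uhat qhat)
    (h : IsInteriorFacet K i j i' j') : Set.EqOn (qhat i j) (qhat i' j') (facet (K i) j) := by
  intro x hx
  rw [hHDG.qhat_interior _ _ _ _ h x hx, hHDG.qhat_interior _ _ _ _ h.symm x (h.2 ▸ hx),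
    add_comm (τ i' j' x), mul_comm (τ i' j' x), add_comm (u i' x • _)]
  abel

theorem IsHDGSolution.integrableOn_qhat_dirichlet
    (hHDG : IsHDGSolution Ω ΓD ΓN K p ν f gD gN τ u q uhat qhat) (hτmeas : Measurable (τ i j))
    {C : ℝ} (hτ : ∀ x ∈ facet (K i) j, ‖τ i j x‖ ≤ C) (h : IsBoundaryFacet Ω ΓD (K i) j) :
    IntegrableOn (fun x => ⟪qhat i j x, normal (K i) j⟫) (facet (K i) j) (surf d) := by
  have hq := ((hHDG.q_poly i).inner_const (normal (K i) j)).continuous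
  have hu : Continuous fun x => u i x - projFacet (K i) j p gD x :=
    ((hHDG.u_poly i).sub (isPoly_l2Proj _ p gD)).continuous
  refine (integrableOn_congr_fun (fun x hx => ?_) (isCompact_facet _ j).measurableSet).2
    ((integrableOn_facet _ hq.continuousOn).add
      (integrableOn_facet_bdd_mul _ hτmeas hτ hu.continuousOn))
  exact hHDG.qhat_dirichlet i j h x hx

theorem IsHDGSolution.integrableOn_qhat_neumann
    (hHDG : IsHDGSolution Ω ΓD ΓN K p ν f gD gN τ u q uhat qhat)
    (h : IsBoundaryFacet Ω ΓN (K i) j) :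
    IntegrableOn (fun x => ⟪qhat i j x, normal (K i) j⟫) (facet (K i) j) (surf d) :=
  (integrableOn_congr_fun (hHDG.qhat_neumann i j h) (isCompact_facet _ j).measurableSet).2
    (integrableOn_facet _ (isPoly_l2Proj _ p gN).continuous.continuousOn)

theorem IsHDGSolution.integrableOn_qhat_interior
    (hHDG : IsHDGSolution Ω ΓD ΓN K p ν f gD gN τ u q uhat qhat)
    (hτmeas : ∀ i j, Measurable (τ i j)) (hτpos : ∀ i j, ∀ x ∈ facet (K i) j, 0 < τ i j x)
    {C : ℝ} (hτ : ∀ x ∈ facet (K i) j, ‖τ i j x‖ ≤ C) (h : IsInteriorFacet K i j i' j') :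
    IntegrableOn (fun x => ⟪qhat i j x, normal (K i) j⟫) (facet (K i) j) (surf d) := by
  set n := normal (K i) j
  have hq (i : ι) := ((hHDG.q_poly i).inner_const n).continuous
  have hu : Continuous fun x => ⟪u i x • n + u i' x • normal (K i') j', n⟫ :=
    (((hHDG.u_poly i).continuous.smul continuous_const).add
      ((hHDG.u_poly i').continuous.smul continuous_const)).inner continuous_const
  have hm := hτmeas i j
  have hm' := hτmeas i' j'
  have hsum := hm.add hm'
  have hpos {x : Pt d} (hx : x ∈ facet (K i) j) : 0 < τ i j x ∧ 0 < τ i' j' x :=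
    ⟨hτpos i j x hx, hτpos i' j' x (h.2 ▸ hx)⟩
  have hweight {a b : ℝ} (ha : 0 < a) (hb : 0 < b) : ‖a / (a + b)‖ ≤ 1 := by
    rw [Real.norm_of_nonneg (by positivity), div_le_one (by positivity)]
    exact le_add_of_nonneg_right hb.le
  have hq_self := integrableOn_facet_bdd_mul (K i) (j := j) (hm'.div hsum) (C := 1)
    (fun x hx => by simpa [add_comm] using hweight (hpos hx).2 (hpos hx).1) (hq i).continuousOn
  have hq_other := integrableOn_facet_bdd_mul (K i) (j := j) (hm.div hsum) (C := 1)
    (fun x hx => hweight (hpos hx).1 (hpos hx).2) (hq i').continuousOn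
  have hu_jump := integrableOn_facet_bdd_mul (K i) (j := j) ((hm.mul hm').div hsum) (C := C)
    (fun x hx => by
      have hτ' := hweight (hpos hx).2 (hpos hx).1
      simp only [Pi.div_apply, Pi.mul_apply, Pi.add_apply]
      rw [add_comm, mul_div_assoc, norm_mul, ← mul_one C]
      exact mul_le_mul (hτ x hx) hτ' (norm_nonneg _) ((norm_nonneg _).trans (hτ x hx)))
    hu.continuousOn
  refine (integrableOn_congr_fun (fun x hx => ?_) (isCompact_facet _ j).measurableSet).2
    ((hq_self.add hq_other).add hu_jump)
  simp only [hHDG.qhat_interior _ _ _ _ h x hx, inner_add_left, real_inner_smul_left]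
  simp [n]

end NumericalFlux

section HDGConservation

variable {d : ℕ} [d.AtLeastTwo] {ι : Type*} {Ω ΓD ΓN : Set (Pt d)}
  {K : ι → Affine.Simplex ℝ (Pt d) d} {p : ℕ} {ν f gD gN : Pt d → ℝ}
  {τ : ι → Fin (d + 1) → Pt d → ℝ} {u : ι → Pt d → ℝ} {q : ι → Pt d → Pt d}
  {uhat : ι → Fin (d + 1) → Pt d → ℝ} {qhat : ι → Fin (d + 1) → Pt d → Pt d}

theorem IsHDGSolution.isConservativeFlux [Finite ι] (hΩ : IsOpen Ω) (hK : IsMesh Ω K)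
    (hΓ : IsBoundarySplit Ω ΓD ΓN K) (hgN : MemLp gN 2 ((surf d).restrict ΓN))
    (hτmeas : ∀ i j, Measurable (τ i j)) (hτpos : ∀ i j, ∀ x ∈ facet (K i) j, 0 < τ i j x)
    {C : ℝ} (hτ : ∀ i j, ∀ x ∈ facet (K i) j, τ i j x ≤ C)
    (hHDG : IsHDGSolution Ω ΓD ΓN K p ν f gD gN τ u q uhat qhat) :
    IsConservativeFlux Ω ΓN K p f gN q qhat where
  continuous i := ((hHDG.q_poly i).contDiff (n := 0)).continuous
  integrableOn_normal i j := by
    have hτnorm (x) (hx : x ∈ facet (K i) j) : ‖τ i j x‖ ≤ C :=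
      (Real.norm_of_nonneg (hτpos i j x hx).le).trans_le (hτ i j x hx)
    by_cases hfacet : facet (K i) j ⊆ frontier Ω
    · obtain hD | hN := hΓ.resolved i j hfacet
      · exact hHDG.integrableOn_qhat_dirichlet (hτmeas i j) hτnorm hD
      · exact hHDG.integrableOn_qhat_neumann hN
    · obtain ⟨i', j', h⟩ := hK.exists_isInteriorFacet hΩ hfacet
      exact hHDG.integrableOn_qhat_interior hτmeas hτpos hτnorm h
  transmission i j i' j' h w _ := by
    rw [← h.2, hK.normal_eq_neg h, add_eq_zero_iff_eq_neg, ← integral_neg]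
    refine setIntegral_congr_fun (isCompact_facet _ j).measurableSet fun x hx => ?_
    simp only [hHDG.qhat_eq h hx, inner_neg_right, neg_mul, neg_neg]
  neumann i j h w hw := by
    rw [← h.integral_projFacet_mul hgN hw]
    refine setIntegral_congr_fun (isCompact_facet _ j).measurableSet fun x hx => ?_
    simp only [hHDG.qhat_neumann i j h x hx]
  balance := hHDG.eq_balance

end HDGConservation

section Postprocessing

variable {d : ℕ} [NeZero d] {ι : Type*} {Ω ΓN : Set (Pt d)} {K : ι → Affine.Simplex ℝ (Pt d) d}
  {p : ℕ} {f gN w : Pt d → ℝ} {q σ : ι → Pt d → Pt d} {qhat : ι → Fin (d + 1) → Pt d → Pt d}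

theorem IsPostprocessedFlux.contDiff (hσ : IsPostprocessedFlux K p q qhat σ) (i : ι)
    {n : WithTop ℕ∞} : ContDiff ℝ n (σ i) :=
  (hσ.raviartThomas i).isPolyVec.contDiff

theorem IsPostprocessedFlux.integral_facet_mul_eq (hσ : IsPostprocessedFlux K p q qhat σ)
    (hflux : IsConservativeFlux Ω ΓN K p f gN q qhat) (i : ι) (j : Fin (d + 1)) (hw : IsPoly p w) :
    ∫ x in facet (K i) j, ⟪σ i x, normal (K i) j⟫ * w x ∂(surf d) =
      ∫ x in facet (K i) j, ⟪qhat i j x, normal (K i) j⟫ * w x ∂(surf d) := by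
  have hσw : IntegrableOn (fun x => ⟪σ i x, normal (K i) j⟫ * w x) (facet (K i) j) (surf d) :=
    integrableOn_facet _ (((hσ.contDiff i (n := 0)).continuous.inner
      continuous_const).mul hw.continuous).continuousOn
  have hqw := (hflux.integrableOn_normal i j).mul_continuousOn hw.continuous.continuousOn
    (isCompact_facet _ j)
  have hmoment := hσ.facet_moments i j w hw
  simp only [inner_sub_left, sub_mul] at hmoment
  rwa [integral_sub hσw hqw, sub_eq_zero] at hmoment

theorem IsPostprocessedFlux.integral_inner_gradient_eq (hσ : IsPostprocessedFlux K p q qhat σ)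
    (hq : ∀ i, Continuous (q i)) (i : ι) (hw : IsPoly p w) :
    ∫ x in (K i).closedInterior, ⟪σ i x, gradient w x⟫ =
      ∫ x in (K i).closedInterior, ⟪q i x, gradient w x⟫ := by
  obtain rfl | hp := p.eq_zero_or_pos
  · simp only [hw.gradient_eq_zero, inner_zero_right]
  · have hint {v : Pt d → Pt d} (hv : Continuous v) :
        IntegrableOn (fun x => ⟪v x, gradient w x⟫) (K i).closedInterior :=
      (hv.inner (continuous_gradient hw.contDiff)).continuousOn.integrableOn_compact
        (K i).isCompact_closedInterior
    have hmoment := hσ.element_moments hp i _ hw.gradient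
    simp only [inner_sub_left] at hmoment
    rwa [integral_sub (hint (hσ.contDiff i (n := 0)).continuous) (hint (hq i)), sub_eq_zero]
      at hmoment

theorem IsPostprocessedFlux.divergence_ae_eq_projElt (hΩreg : interior (closure Ω) = Ω)
    (hK : IsMesh Ω K) (hf : MemLp f 2 (volume.restrict Ω))
    (hσ : IsPostprocessedFlux K p q qhat σ) (hflux : IsConservativeFlux Ω ΓN K p f gN q qhat)
    (i : ι) : divergence (σ i) =ᵐ[volume.restrict (K i).closedInterior] projElt (K i) p f := by
  have hpoly (w : Pt d → ℝ) (hw : IsPoly p w) :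
      MemLp w 2 (volume.restrict (K i).closedInterior) :=
    memLp_restrict_closedInterior _ hw.continuous.continuousOn
  have hfK := hf.mono_measure (hK.restrict_closedInterior_le hΩreg i)
  refine IsL2Proj.ae_eq hpoly hfK ((isL2Proj_iff hpoly hfK).2
    ⟨(hσ.raviartThomas i).isPolyVec.divergence, fun w hw => ?_⟩) (l2Proj_spec _ p f hpoly hfK)
  have hparts := integral_inner_gradient_add_divergence (K i) (hσ.contDiff i) hw.contDiff
  simp only [hσ.integral_facet_mul_eq hflux i _ hw,
    hσ.integral_inner_gradient_eq hflux.continuous i hw] at hparts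
  rw [← hflux.balance i w hw, ← hparts, neg_add_cancel_left]

end Postprocessing

section NormalComponent

variable {d : ℕ} [d.AtLeastTwo] {ι : Type*} {Ω ΓN : Set (Pt d)}
  {K : ι → Affine.Simplex ℝ (Pt d) d} {p : ℕ} {f gN : Pt d → ℝ} {q σ : ι → Pt d → Pt d}
  {qhat : ι → Fin (d + 1) → Pt d → Pt d}

theorem IsPostprocessedFlux.isNormalContinuous (hK : IsMesh Ω K)
    (hσ : IsPostprocessedFlux K p q qhat σ) (hflux : IsConservativeFlux Ω ΓN K p f gN q qhat) :
    IsNormalContinuous K σ := by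
  intro i j i' j' h
  refine (hσ.raviartThomas i).isPolyOn_facet.eqOn_facet (hσ.raviartThomas i').isPolyOn_facet
    fun w hw => ?_
  have hneg : ∫ x in facet (K i) j, ⟪σ i' x, normal (K i) j⟫ * w x ∂(surf d) =
      -∫ x in facet (K i') j', ⟪σ i' x, normal (K i') j'⟫ * w x ∂(surf d) := by
    simp only [← h.2, hK.normal_eq_neg h, inner_neg_right, neg_mul, integral_neg, neg_neg]
  rw [hneg, hσ.integral_facet_mul_eq hflux i j hw, hσ.integral_facet_mul_eq hflux i' j' hw]
  exact eq_neg_of_add_eq_zero_left (hflux.transmission i j i' j' h w hw)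

theorem IsPostprocessedFlux.inner_normal_eqOn_projFacet
    (hgN : MemLp gN 2 ((surf d).restrict ΓN)) (hσ : IsPostprocessedFlux K p q qhat σ)
    (hflux : IsConservativeFlux Ω ΓN K p f gN q qhat) {i : ι} {j : Fin (d + 1)}
    (h : IsBoundaryFacet Ω ΓN (K i) j) :
    Set.EqOn (fun x => ⟪σ i x, normal (K i) j⟫) (projFacet (K i) j p gN) (facet (K i) j) := by
  refine (hσ.raviartThomas i).isPolyOn_facet.eqOn_facet ((isPoly_l2Proj _ p gN).isPolyOn _)
    fun w hw => ?_
  rw [hσ.integral_facet_mul_eq hflux i j hw, hflux.neumann i j h w hw]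
  exact (h.integral_projFacet_mul hgN hw).symm

end NormalComponent

end HDG

theorem mainTheorem5_general {d : ℕ} [d.AtLeastTwo] {ι : Type*} [Fintype ι] {Ω ΓN : Set (Pt d)}
    (hΩ : IsOpen Ω) (hΩreg : interior (closure Ω) = Ω) {K : ι → Affine.Simplex ℝ (Pt d) d}
    (hK : IsMesh Ω K) {f gN : Pt d → ℝ} (hf : MemLp f 2 (volume.restrict Ω))
    (hgN : MemLp gN 2 ((surf d).restrict ΓN)) {p : ℕ} {q σ : ι → Pt d → Pt d}
    {qhat : ι → Fin (d + 1) → Pt d → Pt d} (hflux : IsConservativeFlux Ω ΓN K p f gN q qhat)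
    (hσ : IsPostprocessedFlux K p q qhat σ) :
    IsProjectedEquilibratedFlux Ω ΓN K f gN p p σ := by
  have hC (i : ι) : ContDiff ℝ 1 (σ i) := hσ.contDiff i
  have hnormal : IsNormalContinuous K σ := hσ.isNormalContinuous hK hflux
  exact
    { mem_hdiv := hnormal.memHDiv_glue hΩ hΩreg hK hC
      div_eq := fun _ hg i => (hnormal.ae_eq_divergence hΩ hΩreg hK hC hg i).trans
        (hσ.divergence_ae_eq_projElt hΩreg hK hf hflux i)
      normal_eq := fun _ _ h => hσ.inner_normal_eqOn_projFacet hgN hflux h }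

theorem mainTheorem5 {d : ℕ} [NeZero d] (hd : d = 2 ∨ d = 3) {ι : Type*} [Fintype ι]
    (Ω ΓD ΓN : Set (Pt d))
    (hΩ : IsOpen Ω) (hΩconn : IsConnected Ω) (hΩreg : interior (closure Ω) = Ω)
    (K : ι → Affine.Simplex ℝ (Pt d) d) (hK : IsMesh Ω K)
    (hΓ : IsBoundarySplit Ω ΓD ΓN K)
    (ν f gD gN : Pt d → ℝ)
    (hνpos : ∀ x ∈ Ω, 0 < ν x)
    (hνconst : ∀ i, ∃ c : ℝ, ∀ x ∈ (K i).interior, ν x = c)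
    (hf : MeasureTheory.MemLp f 2 (MeasureTheory.volume.restrict Ω))
    (hgD : ContinuousOn gD ΓD) (hgD2 : MeasureTheory.MemLp gD 2 ((surf d).restrict ΓD))
    (hgN : MeasureTheory.MemLp gN 2 ((surf d).restrict ΓN))
    (τ : ι → Fin (d + 1) → Pt d → ℝ)
    (hτmeas : ∀ i j, Measurable (τ i j))
    (hτ : ∃ c C : ℝ, 0 < c ∧ ∀ i j, ∀ x ∈ facet (K i) j, c ≤ τ i j x ∧ τ i j x ≤ C)
    (p : ℕ)
    (u : ι → Pt d → ℝ) (q : ι → Pt d → Pt d)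
    (uhat : ι → Fin (d + 1) → Pt d → ℝ) (qhat : ι → Fin (d + 1) → Pt d → Pt d)
    (hHDG : IsHDGSolution Ω ΓD ΓN K p ν f gD gN τ u q uhat qhat)
    (σ : ι → Pt d → Pt d)
    (hσ : IsPostprocessedFlux K p q qhat σ) :
    IsProjectedEquilibratedFlux Ω ΓN K f gN p p σ := by
  have : d.AtLeastTwo := ⟨by omega⟩
  obtain ⟨c, C, hc, hτ⟩ := hτ
  exact mainTheorem5_general hΩ hΩreg hK hf hgN
    (hHDG.isConservativeFlux hΩ hK hΓ hgN hτmeas (fun i j x hx => hc.trans_le (hτ i j x hx).1)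
      fun i j x hx => (hτ i j x hx).2) hσ
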